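/- Let $n$ be a positive integer and let $\alpha$ and $\beta$ be partitions of $n$ with no part equal to $1$. Let $C_\alpha$ and $C_\beta$ be the conjugacy classes of the symmetric group $\mathfrak{S}_n$ consisting of the permutations of cycle type $\alpha$ and $\beta$, respectively. Choose $\sigma$ uniformly at random from $C_\alpha$ and, independently, $\omega$ uniformly at random from $C_\beta$, and let $C_{\alpha,\beta}$ be the number of cycles of $\sigma\omega$, where fixed points are counted as cycles. Then $$H_n - 3 < \mathbb{E}[C_{\alpha,\beta}] \le H_n + 1,$$ where $H_n = \sum_{i=1}^n \frac1i$ is the $n$-th harmonic number. -/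

import Mathlib

/-- The number of cycles of a permutation of `{0, …, n-1}`, every fixed point counting as a
cycle of length one: `σ.partition` is the full cycle type, with a part `1` per fixed point. -/
def numCycles {n : ℕ} (σ : Equiv.Perm (Fin n)) : ℕ :=
  Multiset.card σ.partition.parts

/-- The conjugacy class of the symmetric group on `n` symbols indexed by the partition `α` of `n`:
the permutations whose cycle lengths (fixed points included) are the parts of `α`. -/
def conjClass {n : ℕ} (α : n.Partition) : Finset (Equiv.Perm (Fin n)) :=
  Finset.univ.filter fun σ => σ.partition.parts = α.parts

/-- Every class is nonempty, so the average below never divides by zero. -/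
theorem conjClass_nonempty {n : ℕ} (α : n.Partition) : (conjClass α).Nonempty := by
  have hsum : (α.parts.filter (2 ≤ ·)).sum ≤ n := by
    have h := congrArg Multiset.sum (Multiset.filter_add_not (2 ≤ ·) α.parts)
    rw [Multiset.sum_add, α.parts_sum] at h
    omega
  obtain ⟨σ, hσ⟩ := (Equiv.Perm.exists_with_cycleType_iff (α := Fin n)
    (m := α.parts.filter (2 ≤ ·))).2 ⟨by simpa using hsum, fun a ha => (Multiset.mem_filter.1 ha).2⟩
  refine ⟨σ, Finset.mem_filter.2 ⟨Finset.mem_univ _, ?_⟩⟩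
  have hones : α.parts.filter (¬ 2 ≤ ·) = Multiset.replicate
      (Multiset.card (α.parts.filter (¬ 2 ≤ ·))) 1 := by
    refine Multiset.eq_replicate_card.2 fun b hb => ?_
    have h1 := (Multiset.mem_filter.1 hb).2
    have h2 := α.parts_pos (Multiset.mem_filter.1 hb).1
    omega
  have hsplit := Multiset.filter_add_not (2 ≤ ·) α.parts
  have hn : (α.parts.filter (2 ≤ ·)).sum + Multiset.card (α.parts.filter (¬ 2 ≤ ·)) = n := by
    have h := congrArg Multiset.sum hsplit
    rw [Multiset.sum_add, α.parts_sum, hones, Multiset.sum_replicate] at h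
    simpa using h
  rw [Equiv.Perm.parts_partition, hσ, ← Equiv.Perm.sum_cycleType, hσ, Fintype.card_fin]
  rw [show n - (α.parts.filter (2 ≤ ·)).sum = Multiset.card (α.parts.filter (¬ 2 ≤ ·)) by omega,
    ← hones]
  exact hsplit

/-- The expected number of cycles of `σ * ω`, for independent `σ` and `ω` uniformly distributed
on the conjugacy classes indexed by `α` and `β`. -/
noncomputable def expectedCycles {n : ℕ} (α β : n.Partition) : ℝ :=
  (∑ σ ∈ conjClass α, ∑ ω ∈ conjClass β, (numCycles (σ * ω) : ℝ)) /
    ((conjClass α).card * (conjClass β).card)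

/-! A conjugacy class is invariant under conjugation, so it suffices to fix fixed-point-free `σ` and
`ω` and bound the mean number of cycles of `σ * (π⁻¹ * ω * π)` over uniform `π`
(`average_conj_bounds`). Let `ρ` act as `σ` on a black copy of `Fin n` and as `ω` on a white copy,
and read `π` as a perfect matching `ι` of the copies. The cycles wanted correspond to those of `ρ *
ι`, the faces of a map whose vertices are the cycles of `ρ` and whose edges are the pairs of `ι`.

Reveal the matching one edge at a time. The black point `b` may be chosen freely and its partner `w`
is uniform; contracting the edge `bw` gives the recurrence `mul_meanFaces`. Contraction mixes the
colours within cycles, so the induction on the number `k` of points of each colour treats arbitrary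
two-coloured `ρ`. Both bounds have the form `2 H_k - H_m + O(1)`, where `m` counts the
black-to-black arcs (equally, the white-to-white ones). Initially `m = k = n`, which gives `H_n +
O(1)`.

Passing to `k` from `k - 1`, the term `2 H_k` allows a total gain of `2` over the `k` choices of
`w`. The gain of one choice is the number of faces it closes plus `H_m - H_m'`, with `m'` the new
arc count. A good `b` makes the total `2` up to lower-order terms: the end of a monochromatic run, a
point where the colours alternate locally, or any point if no arc is bicoloured. Fixed points of `ρ`
spoil the balance. They are kept few by treating them as `b` when necessary, and paid for by the
correction terms in `1/m` (`meanFaces_le_upperBound`, `lowerBound_le_meanFaces`). -/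

section ProductsOfConjugacyClasses

open Equiv Equiv.Perm

/-! ### Counting cycles -/

section CycleCount

variable {V : Type}

/-- The number of cycles of a permutation, fixed points included. -/
noncomputable def cycleCount (τ : Perm V) : ℕ :=
  Nat.card (Quotient (SameCycle.setoid τ))

theorem rel_of_sameCycle {σ : Perm V} {r : V → V → Prop} (hr : Equivalence r)
    (h : ∀ a, r a (σ a)) {a b : V} (hab : SameCycle σ a b) : r a b := by
  obtain ⟨i, rfl⟩ := hab
  induction i using Int.induction_on with
  | zero => simpa using hr.refl a
  | succ i ih =>
    have := h ((σ ^ (i : ℤ)) a)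
    rw [add_comm, zpow_add, zpow_one]
    exact hr.trans ih this
  | pred i ih =>
    have := h ((σ ^ (-(i : ℤ) - 1)) a)
    rw [← Perm.mul_apply, ← zpow_one_add] at this
    rw [show 1 + (-(i : ℤ) - 1) = -i by ring] at this
    exact hr.trans ih (hr.symm this)

/-- The transposition returns `x` to itself and sends the predecessor of `x` on to `τ x`: `x` is cut
out as a fixed point and the rest of its cycle closes up. -/
theorem sameCycle_swap_mul_iff [DecidableEq V] (τ : Perm V) {x : V} (hx : τ x ≠ x) (a b : V) :
    SameCycle (swap x (τ x) * τ) a b ↔ a = b ∨ (a ≠ x ∧ b ≠ x ∧ SameCycle τ a b) := by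
  have hfix : ∀ c, c ≠ x → (swap x (τ x) * τ) c ≠ x := by
    intro c hc h
    rw [Perm.mul_apply, swap_apply_eq_iff, swap_apply_left] at h
    exact hc (τ.injective h)
  constructor
  · apply rel_of_sameCycle (r := fun a b => a = b ∨ (a ≠ x ∧ b ≠ x ∧ SameCycle τ a b))
    · refine ⟨fun a => Or.inl rfl, ?_, ?_⟩
      · rintro a b (rfl | ⟨h1, h2, h3⟩)
        · exact Or.inl rfl
        · exact Or.inr ⟨h2, h1, h3.symm⟩
      · rintro a b c (rfl | ⟨h1, h2, h3⟩) (rfl | ⟨h4, h5, h6⟩)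
        · exact Or.inl rfl
        · exact Or.inr ⟨h4, h5, h6⟩
        · exact Or.inr ⟨h1, h2, h3⟩
        · exact Or.inr ⟨h1, h5, h3.trans h6⟩
    · intro a
      by_cases ha : a = x
      · subst ha; left; simp
      · right
        refine ⟨ha, hfix a ha, ?_⟩
        rw [Perm.mul_apply]
        by_cases h1 : τ a = x
        · rw [h1, swap_apply_left, ← h1]
          exact ((SameCycle.refl τ a).apply_right).apply_right
        · rw [swap_apply_of_ne_of_ne h1 (fun h => ha (τ.injective h))]
          exact (SameCycle.refl τ a).apply_right
  · rintro (rfl | ⟨h1, h2, h3⟩)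
    · exact SameCycle.refl _ _
    · have key := rel_of_sameCycle (σ := τ)
        (r := fun a b => SameCycle (swap x (τ x) * τ) (if a = x then τ x else a)
          (if b = x then τ x else b))
        ⟨fun a => SameCycle.refl _ _, fun h => h.symm, fun h h' => h.trans h'⟩ (fun a => ?_) h3
      · simpa [h1, h2] using key
      · by_cases ha : a = x
        · subst ha; simp [hx, SameCycle.refl]
        · rw [if_neg ha]
          have : (if τ a = x then τ x else τ a) = (swap x (τ x) * τ) a := by
            rw [Perm.mul_apply]
            split_ifs with h
            · rw [h, swap_apply_left]
            · rw [swap_apply_of_ne_of_ne h (fun h => ha (τ.injective h))]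
          rw [this]
          exact (SameCycle.refl _ a).apply_right

theorem cycleCount_swap_mul [Fintype V] [DecidableEq V] (τ : Perm V) {x : V} (hx : τ x ≠ x) :
    cycleCount (swap x (τ x) * τ) = cycleCount τ + 1 := by
  classical
  -- Each old cycle has a representative that survives the deletion of `x`; `none` below stands for
  -- the new cycle `{x}`.
  let p : V → V := fun a => if a = x then τ x else a
  have hpx : ∀ a, p a ≠ x := by
    intro a; by_cases h : a = x <;> simp [p, h, hx]
  have hp : ∀ a, SameCycle τ (p a) a := by
    intro a
    by_cases h : a = x
    · subst h; simpa [p] using SameCycle.refl τ a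
    · simpa [p, h] using SameCycle.refl τ a
  let f : Option (Quotient (SameCycle.setoid τ)) →
      Quotient (SameCycle.setoid (swap x (τ x) * τ)) := fun o =>
    match o with
    | none => Quotient.mk _ x
    | some q => Quotient.lift (s := SameCycle.setoid τ)
        (fun a => Quotient.mk (SameCycle.setoid (swap x (τ x) * τ)) (p a)) (fun a b hab =>
        Quotient.sound ((sameCycle_swap_mul_iff τ hx _ _).2
          (Or.inr ⟨hpx a, hpx b, ((hp a).trans hab).trans (hp b).symm⟩))) q
  have hf : Function.Bijective f := by
    constructor
    · rintro (_ | q) (_ | q') h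
      · rfl
      · induction q' using Quotient.inductionOn with | _ a =>
        have := (sameCycle_swap_mul_iff τ hx _ _).1 (Quotient.exact h)
        rcases this with h | h
        · exact absurd h.symm (hpx a)
        · exact absurd rfl h.1
      · induction q using Quotient.inductionOn with | _ a =>
        have := (sameCycle_swap_mul_iff τ hx _ _).1 (Quotient.exact h)
        rcases this with h | h
        · exact absurd h (hpx a)
        · exact absurd rfl h.2.1
      · induction q using Quotient.inductionOn with | _ a =>
        induction q' using Quotient.inductionOn with | _ b =>
        have := (sameCycle_swap_mul_iff τ hx _ _).1 (Quotient.exact h)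
        congr 1
        apply Quotient.sound
        change SameCycle τ a b
        rcases this with h | h
        · exact ((hp a).symm.trans (by rw [h])).trans (hp b)
        · exact ((hp a).symm.trans h.2.2).trans (hp b)
    · intro q
      induction q using Quotient.inductionOn with | _ a =>
      by_cases h : a = x
      · exact ⟨none, by subst h; rfl⟩
      · refine ⟨some (Quotient.mk _ a), ?_⟩
        change Quotient.mk _ (p a) = _
        simp [p, h]
  have := Nat.card_eq_of_bijective f hf
  rw [cycleCount, cycleCount, ← this, Finite.card_option]

theorem cycleCount_conj (g τ : Perm V) : cycleCount (g * τ * g⁻¹) = cycleCount τ := by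
  symm
  refine Nat.card_congr (Quotient.congr g fun a b => ?_)
  change SameCycle τ a b ↔ SameCycle (g * τ * g⁻¹) (g a) (g b)
  simp [sameCycle_conj]

theorem cycleCount_inv (τ : Perm V) : cycleCount τ⁻¹ = cycleCount τ := by
  refine Nat.card_congr (Quotient.congr (Equiv.refl V) fun a b => ?_)
  change SameCycle τ⁻¹ a b ↔ SameCycle τ a b
  simp [sameCycle_inv]

theorem card_parts_partition_eq_cycleCount [Fintype V] [DecidableEq V] (σ : Perm V) :
    Multiset.card σ.partition.parts = cycleCount σ := by
  classical
  let q : V → σ.cycleFactorsFinset ⊕ {x // σ x = x} := fun x =>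
    if h : σ x = x then Sum.inr ⟨x, h⟩
    else Sum.inl ⟨σ.cycleOf x, cycleOf_mem_cycleFactorsFinset_iff.2 (mem_support.2 h)⟩
  have hq : Function.Surjective q := by
    rintro (⟨c, hc⟩ | ⟨x, hx⟩)
    · obtain ⟨x, hx⟩ := (mem_cycleFactorsFinset_iff.1 hc).1.nonempty_support
      have hcx := cycle_is_cycleOf hx hc
      have hs : x ∈ σ.support := mem_cycleFactorsFinset_support_le hc hx
      refine ⟨x, ?_⟩
      simp only [q]
      rw [dif_neg (mem_support.1 hs)]
      simp [hcx]
    · exact ⟨x, by simp [q, hx]⟩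
  have hker : ∀ a b, q a = q b ↔ SameCycle σ a b := by
    intro a b
    by_cases ha : σ a = a <;> by_cases hb : σ b = b
    · simp only [q, ha, hb, dif_pos, Sum.inr.injEq, Subtype.mk.injEq]
      constructor
      · rintro rfl; exact SameCycle.refl _ _
      · intro h; exact h.eq_of_left ha
    · simp only [q, ha, hb, dif_pos, dif_neg, not_false_eq_true, reduceCtorEq, false_iff]
      intro h; exact hb (by rw [← h.eq_of_left ha]; exact ha)
    · simp only [q, ha, hb, dif_pos, dif_neg, not_false_eq_true, reduceCtorEq, false_iff]
      intro h; exact ha (by rw [← h.symm.eq_of_left hb]; exact hb)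
    · simp only [q, ha, hb, dif_neg, not_false_eq_true, Sum.inl.injEq, Subtype.mk.injEq]
      exact (sameCycle_iff_cycleOf_eq_of_mem_support (mem_support.2 ha) (mem_support.2 hb)).symm
  have h1 : cycleCount σ = Nat.card (σ.cycleFactorsFinset ⊕ {x // σ x = x}) := by
    refine Nat.card_congr ((Quotient.congr (Equiv.refl V) fun a b => ?_).trans
      (Setoid.quotientKerEquivOfSurjective q hq))
    exact (hker a b).symm
  have h2 : Fintype.card {x // σ x = x} = Fintype.card V - σ.support.card := by
    rw [Fintype.card_subtype, ← Finset.card_compl]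
    congr 1
    ext x; simp
  rw [h1, Nat.card_sum, Nat.card_eq_fintype_card, Nat.card_eq_fintype_card, h2, parts_partition]
  simp [cycleType_def]

theorem numCycles_eq_cycleCount {n : ℕ} (σ : Perm (Fin n)) : numCycles σ = cycleCount σ :=
  card_parts_partition_eq_cycleCount σ

/-- Every cycle of `κ` meets `A`, and two steps of `κ` from a point of `A` are one step of the
composite. -/
theorem cycleCount_eq_of_alternating {A B : Type} (κ : Perm (A ⊕ B)) (f : A ≃ B) (g : B ≃ A)
    (hf : ∀ a, κ (Sum.inl a) = Sum.inr (f a)) (hg : ∀ b, κ (Sum.inr b) = Sum.inl (g b)) :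
    cycleCount κ = cycleCount (f.trans g : Perm A) := by
  symm
  have hstep : ∀ a, SameCycle κ (Sum.inl a) (Sum.inl ((f.trans g : Perm A) a)) := by
    intro a
    have : (Sum.inl ((f.trans g : Perm A) a) : A ⊕ B) = κ (κ (Sum.inl a)) := by
      rw [hf, hg]; rfl
    rw [this]
    exact (SameCycle.refl κ _).apply_right.apply_right
  let p : A ⊕ B → A := Sum.elim id g
  let F : Quotient (SameCycle.setoid (f.trans g : Perm A)) → Quotient (SameCycle.setoid κ) :=
    Quotient.lift (s := SameCycle.setoid (f.trans g : Perm A))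
      (fun a => Quotient.mk (SameCycle.setoid κ) (Sum.inl a)) (fun a b hab => Quotient.sound
        (rel_of_sameCycle (σ := (f.trans g : Perm A))
          (r := fun a b => SameCycle κ (Sum.inl a) (Sum.inl b))
          ⟨fun _ => SameCycle.refl _ _, fun h => h.symm, fun h h' => h.trans h'⟩ hstep hab))
  refine Nat.card_eq_of_bijective F ⟨?_, ?_⟩
  · intro q q' h
    induction q using Quotient.inductionOn with | _ a =>
    induction q' using Quotient.inductionOn with | _ b =>
    have h1 : SameCycle κ (Sum.inl a) (Sum.inl b) := Quotient.exact h
    refine Quotient.sound ?_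
    refine rel_of_sameCycle (σ := κ)
      (r := fun x y => SameCycle (f.trans g : Perm A) (p x) (p y))
      ⟨fun _ => SameCycle.refl _ _, fun h => h.symm, fun h h' => h.trans h'⟩ ?_ h1
    rintro (x | y)
    · rw [hf]
      exact (SameCycle.refl (f.trans g : Perm A) x).apply_right
    · rw [hg]
      exact SameCycle.refl _ _
  · intro q
    induction q using Quotient.inductionOn with | _ x =>
    rcases x with a | b
    · exact ⟨Quotient.mk _ a, rfl⟩
    · refine ⟨Quotient.mk _ (g b), Quotient.sound ?_⟩
      change SameCycle κ (Sum.inl (g b)) (Sum.inr b)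
      rw [← hg]
      exact (SameCycle.refl κ (Sum.inr b)).apply_left

end CycleCount

/-! ### Random matchings and edge contraction -/

section Matchings

variable {V : Type} [DecidableEq V]

theorem cycleCount_swap_mul_add [Fintype V] (τ : Perm V) (x : V) :
    cycleCount (swap x (τ x) * τ) + (if τ x = x then 1 else 0) =
      cycleCount τ + 1 := by
  split_ifs with h
  · rw [h, swap_self, ← Perm.one_def, one_mul]
  · simpa using cycleCount_swap_mul τ h

/-- Close up the half-edges `b` and `w`: compose with the transposition `swap b w` and then remove
`b` and `w` from their cycles, keeping them as fixed points. -/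
def contract (ρ : Perm V) (b w : V) : Perm V :=
  swap w ((swap b (ρ w) * (ρ * swap b w)) w) * (swap b (ρ w) * (ρ * swap b w))

/-- The predecessor of `b` is linked to `ρ w` and that of `w` to `ρ b`. The inner conditions treat a
target that is itself removed, when `w` or `b` is fixed by `ρ`. -/
theorem contract_apply (ρ : Perm V) {b w a : V} (hbw : b ≠ w) (hab : a ≠ b) (haw : a ≠ w) :
    contract ρ b w a =
      if ρ a = b then (if ρ w = w then ρ b else ρ w)
      else if ρ a = w then (if ρ b = b then ρ w else ρ b) else ρ a := by
  have h1 : ρ a ≠ ρ b := fun h => hab (ρ.injective h)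
  have h2 : ρ a ≠ ρ w := fun h => haw (ρ.injective h)
  have h3 : ρ b ≠ ρ w := fun h => hbw (ρ.injective h)
  simp only [contract, Perm.mul_apply, swap_apply_def]
  grind

theorem contract_apply_left (ρ : Perm V) {b w : V} (hbw : b ≠ w) : contract ρ b w b = b := by
  have h3 : ρ b ≠ ρ w := fun h => hbw (ρ.injective h)
  simp only [contract, Perm.mul_apply, swap_apply_def]
  grind

theorem contract_apply_right (ρ : Perm V) (b w : V) : contract ρ b w w = w := by
  simp [contract, Perm.mul_apply]

/-- The number of faces completed when `b` is joined to `w`. -/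
def closedFaces (ρ : Perm V) (b w : V) : ℕ :=
  (if ρ w = b then 1 else 0) + (if ρ b = w then 1 else 0) +
    (if ρ b = b ∧ ρ w = w then 1 else 0)

/-- Cutting out a point adds a cycle unless the point is already fixed. Two points are cut out, and
`closedFaces` counts the exceptions. -/
theorem cycleCount_contract [Fintype V] (ρ ι : Perm V) {b w : V} (hbw : b ≠ w)
    (hb : ι b = b) (hw : ι w = w) :
    cycleCount (ρ * (swap b w * ι)) + 2 =
      cycleCount (contract ρ b w * ι) + closedFaces ρ b w := by
  have h3 : ρ b ≠ ρ w := fun h => hbw (ρ.injective h)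
  have e1 := cycleCount_swap_mul_add (ρ * (swap b w * ι)) b
  have e1' : (ρ * (swap b w * ι)) b = ρ w := by simp [hb]
  rw [e1'] at e1
  have e2 := cycleCount_swap_mul_add (swap b (ρ w) * (ρ * (swap b w * ι))) w
  have e2' : (swap b (ρ w) * (ρ * (swap b w * ι))) w = (swap b (ρ w) * (ρ * swap b w)) w := by
    simp [hw]
  rw [e2'] at e2
  have e3 : swap w ((swap b (ρ w) * (ρ * swap b w)) w) * (swap b (ρ w) * (ρ * (swap b w * ι))) =
      contract ρ b w * ι := by
    simp only [contract, mul_assoc]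
  rw [e3] at e2
  have e4 : (swap b (ρ w) * (ρ * swap b w)) w = if ρ b = b then ρ w else ρ b := by
    simp only [Perm.mul_apply, swap_apply_def]
    grind
  rw [e4] at e2
  unfold closedFaces
  have e5 : (if (if ρ b = b then ρ w else ρ b) = w then 1 else 0) =
      (if ρ b = w then 1 else 0) + (if ρ b = b ∧ ρ w = w then 1 else 0) := by
    by_cases h1 : ρ b = b <;> by_cases h2 : ρ w = w <;> by_cases h4 : ρ b = w <;>
      simp_all
  rw [e5] at e2
  omega

/-- The involutions exchanging `B` and `W` and fixing everything else, that is, the perfect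
matchings between `B` and `W`. -/
def matchings [Fintype V] (B W : Finset V) : Finset (Perm V) :=
  Finset.univ.filter fun ι => (∀ x, ι (ι x) = x) ∧ (∀ x ∈ B, ι x ∈ W) ∧ (∀ x ∈ W, ι x ∈ B) ∧
    ∀ x, x ∉ B → x ∉ W → ι x = x

theorem mem_matchings [Fintype V] {B W : Finset V} {ι : Perm V} :
    ι ∈ matchings B W ↔ (∀ x, ι (ι x) = x) ∧ (∀ x ∈ B, ι x ∈ W) ∧ (∀ x ∈ W, ι x ∈ B) ∧
      ∀ x, x ∉ B → x ∉ W → ι x = x := by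
  simp [matchings]

theorem matchings_comm [Fintype V] (B W : Finset V) : matchings B W = matchings W B := by
  ext ι
  simp only [mem_matchings]
  grind

theorem sum_matchings [Fintype V] {M : Type} [AddCommMonoid M] {B W : Finset V}
    (hd : Disjoint B W) {b : V} (hb : b ∈ B) (f : Perm V → M) :
    ∑ ι ∈ matchings B W, f ι =
      ∑ w ∈ W, ∑ ι ∈ matchings (B.erase b) (W.erase w), f (swap b w * ι) := by
  have hd' := Finset.disjoint_left.1 hd
  rw [Finset.sum_sigma']
  refine Finset.sum_bij' (fun ι _ => (⟨ι b, swap b (ι b) * ι⟩ : (_ : V) × Perm V))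
    (fun p _ => swap b p.1 * p.2) ?_ ?_ ?_ ?_ ?_
  · intro ι hι
    obtain ⟨h1, h2, h3, h4⟩ := mem_matchings.1 hι
    have inj : ∀ x y, ι x = ι y → x = y := fun x y h => ι.injective h
    have key : ∀ x, (swap b (ι b) * ι) x = if x = b ∨ x = ι b then x else ι x := by
      intro x
      simp only [Perm.mul_apply, swap_apply_def]
      grind
    simp only [Finset.mem_sigma, mem_matchings]
    refine ⟨h2 b hb, ?_, ?_, ?_, ?_⟩
    · intro x; rw [key, key]; grind
    · intro x hx; rw [key]; grind
    · intro x hx; rw [key]; grind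
    · intro x hx hx'; rw [key]; grind
  · rintro ⟨w, ι⟩ hp
    simp only [Finset.mem_sigma, mem_matchings] at hp
    obtain ⟨hw, h1, h2, h3, h4⟩ := hp
    have inj : ∀ x y, ι x = ι y → x = y := fun x y h => ι.injective h
    have hbw : b ≠ w := fun h => hd' hb (h ▸ hw)
    have ib : ι b = b := h4 b (by simp) (by simp [hd' hb])
    have iw : ι w = w := h4 w (fun h => hd' (Finset.mem_of_mem_erase h) hw) (by simp)
    have key : ∀ x, (swap b w * ι) x = if x = b then w else if x = w then b else ι x := by
      intro x
      simp only [Perm.mul_apply, swap_apply_def]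
      grind
    rw [mem_matchings]
    refine ⟨?_, ?_, ?_, ?_⟩
    · intro x; rw [key, key]; grind
    · intro x hx; rw [key]; grind
    · intro x hx; rw [key]; grind
    · intro x hx hx'; rw [key]; grind
  · intro ι hι
    simp [← mul_assoc]
  · rintro ⟨w, ι⟩ hp
    simp only [Finset.mem_sigma, mem_matchings] at hp
    obtain ⟨hw, h1, h2, h3, h4⟩ := hp
    have ib : ι b = b := h4 b (by simp) (by simp [hd' hb])
    have e : (swap b w * ι) b = w := by simp [ib]
    simp only [e, ← mul_assoc, swap_mul_self, one_mul]
  · intro ι hι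
    simp [← mul_assoc]

theorem card_matchings [Fintype V] {B W : Finset V} (hd : Disjoint B W) (hc : B.card = W.card) :
    (matchings B W).card = B.card.factorial := by
  induction hk : B.card generalizing B W with
  | zero =>
    have hB : B = ∅ := Finset.card_eq_zero.1 hk
    have hW : W = ∅ := Finset.card_eq_zero.1 (hc ▸ hk)
    subst hB hW
    rw [Finset.card_eq_one.2]
    · simp
    · refine ⟨1, ?_⟩
      ext ι
      simp only [mem_matchings, Finset.mem_singleton]
      constructor
      · rintro ⟨-, -, -, h⟩
        ext x
        exact h x (by simp) (by simp)
      · rintro rfl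
        simp
  | succ k ih =>
    obtain ⟨b, hb⟩ : B.Nonempty := Finset.card_pos.1 (by omega)
    rw [Finset.card_eq_sum_ones, sum_matchings hd hb]
    have : ∀ w ∈ W, ∑ ι ∈ matchings (B.erase b) (W.erase w), 1 = k.factorial := by
      intro w hw
      rw [← Finset.card_eq_sum_ones]
      refine ih (hd.mono (Finset.erase_subset _ _) (Finset.erase_subset _ _)) ?_ ?_
      · rw [Finset.card_erase_of_mem hb, Finset.card_erase_of_mem hw, hc]
      · rw [Finset.card_erase_of_mem hb, hk]; rfl
    rw [Finset.sum_congr rfl this, Finset.sum_const, ← hc, hk, Nat.factorial_succ, smul_eq_mul]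

/-- The expected number of cycles of `ρ * ι` on `B ∪ W` for a uniformly random perfect matching
`ι` between `B` and `W`. -/
noncomputable def meanFaces [Fintype V] (ρ : Perm V) (B W : Finset V) : ℝ :=
  (∑ ι ∈ matchings B W, (cycleCount (ρ * ι) : ℝ)) / (B.card.factorial : ℝ) -
    ((Fintype.card V : ℝ) - 2 * B.card)

theorem meanFaces_comm [Fintype V] (ρ : Perm V) {B W : Finset V} (hc : B.card = W.card) :
    meanFaces ρ B W = meanFaces ρ W B := by
  rw [meanFaces, meanFaces, matchings_comm, hc]

/-- As `ι` is an involution, the inverse of `ρ⁻¹ * ι` is `ι * ρ`, a conjugate of `ρ * ι`. This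
symmetry reverses all arcs and halves the case analysis. -/
theorem meanFaces_inv [Fintype V] (ρ : Perm V) (B W : Finset V) :
    meanFaces ρ⁻¹ B W = meanFaces ρ B W := by
  rw [meanFaces, meanFaces]
  congr 2
  refine Finset.sum_congr rfl fun ι hι => ?_
  have h : ι⁻¹ = ι := by
    rw [inv_eq_iff_mul_eq_one]
    ext x
    exact (mem_matchings.1 hι).1 x
  rw [← cycleCount_inv, mul_inv_rev, inv_inv, h, ← cycleCount_conj ι⁻¹]
  congr 2
  group

/-- Condition on the partner `w` of `b`. The `2` in `cycleCount_contract` disappears because `b` and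
`w` join the outside fixed points, which `meanFaces` subtracts. -/
theorem mul_meanFaces [Fintype V] (ρ : Perm V) {B W : Finset V} (hd : Disjoint B W)
    (hc : B.card = W.card) {b : V} (hb : b ∈ B) :
    (B.card : ℝ) * meanFaces ρ B W =
      ∑ w ∈ W, ((closedFaces ρ b w : ℝ) +
        meanFaces (contract ρ b w) (B.erase b) (W.erase w)) := by
  obtain ⟨k, hk⟩ : ∃ k, B.card = k + 1 := ⟨B.card - 1, by have := Finset.card_pos.2 ⟨b, hb⟩; omega⟩
  have hkB : (B.erase b).card = k := by rw [Finset.card_erase_of_mem hb, hk]; rfl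
  have hf : (k.factorial : ℝ) ≠ 0 := by positivity
  have hterm : ∀ w ∈ W, (closedFaces ρ b w : ℝ) +
      meanFaces (contract ρ b w) (B.erase b) (W.erase w) =
      (∑ ι ∈ matchings (B.erase b) (W.erase w), (cycleCount (ρ * (swap b w * ι)) : ℝ)) /
        k.factorial - ((Fintype.card V : ℝ) - 2 * (k + 1)) := by
    intro w hw
    have hbw : b ≠ w := fun h => Finset.disjoint_left.1 hd hb (h ▸ hw)
    have hkW : (W.erase w).card = k := by rw [Finset.card_erase_of_mem hw, ← hc, hk]; rfl
    have hdd : Disjoint (B.erase b) (W.erase w) :=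
      hd.mono (Finset.erase_subset _ _) (Finset.erase_subset _ _)
    have hsum : ∑ ι ∈ matchings (B.erase b) (W.erase w),
        (cycleCount (ρ * (swap b w * ι)) : ℝ) =
        ∑ ι ∈ matchings (B.erase b) (W.erase w),
          ((cycleCount (contract ρ b w * ι) : ℝ) + ((closedFaces ρ b w : ℝ) - 2)) := by
      refine Finset.sum_congr rfl fun ι hι => ?_
      have h4 := (mem_matchings.1 hι).2.2.2
      have := cycleCount_contract ρ ι hbw
        (h4 b (by simp) (by simp [Finset.disjoint_left.1 hd hb]))
        (h4 w (by simp [Finset.disjoint_right.1 hd hw]) (by simp))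
      have : (cycleCount (ρ * (swap b w * ι)) : ℝ) + 2 =
        cycleCount (contract ρ b w * ι) + closedFaces ρ b w := by exact_mod_cast this
      linarith
    rw [hsum, Finset.sum_add_distrib, Finset.sum_const, card_matchings hdd (hkB.trans hkW.symm),
      hkB, meanFaces, hkB, nsmul_eq_mul]
    field_simp
    ring
  rw [Finset.sum_congr rfl hterm, Finset.sum_sub_distrib, Finset.sum_const, ← Finset.sum_div,
    ← sum_matchings hd hb (fun ι => (cycleCount (ρ * ι) : ℝ)), ← hc, hk, meanFaces, hk,
    Nat.factorial_succ, nsmul_eq_mul]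
  push_cast
  field_simp

end Matchings

/-! ### Two-coloured permutations and their statistics -/

section Statistics

variable {V : Type} [DecidableEq V]

/-- `ρ` permutes the black points `B` and the white points `W`, equally many of each, and fixes
everything else. -/
structure IsBicolored (ρ : Perm V) (B W : Finset V) : Prop where
  disjoint : Disjoint B W
  card_eq : B.card = W.card
  apply_eq : ∀ x, x ∉ B → x ∉ W → ρ x = x

/-- The number of points of `B` mapped into `B`. -/
def sameArcs (ρ : Perm V) (B : Finset V) : ℕ := (B.filter (ρ · ∈ B)).card

/-- The number of fixed points in `B`. -/
def fixedCount (ρ : Perm V) (B : Finset V) : ℕ := (B.filter fun x => ρ x = x).card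

variable {ρ : Perm V} {B W : Finset V}

namespace IsBicolored

theorem symm (h : IsBicolored ρ B W) : IsBicolored ρ W B :=
  ⟨h.disjoint.symm, h.card_eq.symm, fun x h1 h2 => h.apply_eq x h2 h1⟩

theorem inv (h : IsBicolored ρ B W) : IsBicolored ρ⁻¹ B W :=
  ⟨h.disjoint, h.card_eq, fun x h1 h2 => by rw [Perm.inv_eq_iff_eq]; exact (h.apply_eq x h1 h2).symm⟩

theorem notMem_right (h : IsBicolored ρ B W) : ∀ x ∈ B, x ∉ W :=
  fun _ hx => Finset.disjoint_left.1 h.disjoint hx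

theorem apply_mem (h : IsBicolored ρ B W) : ∀ x, x ∈ B ∨ x ∈ W → ρ x ∈ B ∨ ρ x ∈ W := by
  intro x hx
  by_contra! hc
  have := h.apply_eq _ hc.1 hc.2
  rw [ρ.injective this] at hc
  tauto

theorem contract (h : IsBicolored ρ B W) {b w : V} (hb : b ∈ B) (hw : w ∈ W) :
    IsBicolored (contract ρ b w) (B.erase b) (W.erase w) := by
  have hbw : b ≠ w := fun e => h.notMem_right b hb (e ▸ hw)
  refine ⟨h.disjoint.mono (Finset.erase_subset _ _) (Finset.erase_subset _ _), ?_, ?_⟩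
  · rw [Finset.card_erase_of_mem hb, Finset.card_erase_of_mem hw, h.card_eq]
  · intro x hx hx'
    by_cases h1 : x = b
    · subst h1; exact contract_apply_left ρ hbw
    by_cases h2 : x = w
    · subst h2; exact contract_apply_right ρ b x
    have h3 := h.apply_eq x (by grind) (by grind)
    rw [contract_apply ρ hbw h1 h2]
    grind

/-- Exactly `B.card` points of `B ∪ W` map into `B`, so the white-to-black arcs are as many as the
black-to-white ones; the classes have equal size. -/
theorem sameArcs_comm (h : IsBicolored ρ B W) : sameArcs ρ W = sameArcs ρ B := by
  have h1 : ((B ∪ W).filter (ρ · ∈ B)).card = B.card := by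
    rw [← Finset.card_map ρ.toEmbedding]
    congr 1
    ext x
    simp only [Finset.mem_map, Finset.mem_filter, Finset.mem_union, Equiv.coe_toEmbedding]
    constructor
    · rintro ⟨a, ⟨-, ha⟩, rfl⟩; exact ha
    · intro hx
      refine ⟨ρ⁻¹ x, ⟨h.inv.apply_mem x (Or.inl hx), by simpa using hx⟩, by simp⟩
  rw [Finset.filter_union, Finset.card_union_of_disjoint
    (h.disjoint.mono (Finset.filter_subset _ _) (Finset.filter_subset _ _))] at h1
  have h2 := Finset.card_filter_add_card_filter_not (s := W) (fun x => ρ x ∈ B)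
  have h3 : (W.filter fun x => ¬ ρ x ∈ B) = W.filter (ρ · ∈ W) := by
    refine Finset.filter_congr fun x hx => ?_
    have h4 := h.apply_mem x (Or.inr hx)
    have h5 := h.notMem_right (ρ x)
    tauto
  rw [h3] at h2
  have := h.card_eq
  unfold sameArcs
  omega

end IsBicolored

theorem sameArcs_inv (ρ : Perm V) (B : Finset V) : sameArcs ρ⁻¹ B = sameArcs ρ B := by
  unfold sameArcs
  symm
  refine Finset.card_bij' (fun x _ => ρ x) (fun x _ => ρ⁻¹ x) ?_ ?_ ?_ ?_ <;> simp <;> tauto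

theorem fixedCount_inv (ρ : Perm V) (B : Finset V) : fixedCount ρ⁻¹ B = fixedCount ρ B := by
  unfold fixedCount
  congr 1
  refine Finset.filter_congr fun x _ => ?_
  rw [Perm.inv_eq_iff_eq, eq_comm]

theorem fixedCount_le_sameArcs (ρ : Perm V) (B : Finset V) : fixedCount ρ B ≤ sameArcs ρ B := by
  refine Finset.card_le_card fun x hx => ?_
  simp only [Finset.mem_filter] at hx ⊢
  rw [hx.2]
  exact ⟨hx.1, hx.1⟩

theorem sum_indicator_apply_mem (ρ : Perm V) (B : Finset V) :
    ∑ x ∈ B, (if ρ x ∈ B then (1 : ℝ) else 0) = sameArcs ρ B := by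
  rw [Finset.sum_boole]; rfl

theorem sum_indicator_inv_apply_mem (ρ : Perm V) (B : Finset V) :
    ∑ x ∈ B, (if ρ⁻¹ x ∈ B then (1 : ℝ) else 0) = sameArcs ρ B := by
  rw [sum_indicator_apply_mem, sameArcs_inv]

theorem sum_indicator_fixed (ρ : Perm V) (B : Finset V) :
    ∑ x ∈ B, (if ρ x = x then (1 : ℝ) else 0) = fixedCount ρ B := by
  rw [Finset.sum_boole]; rfl

theorem sameArcs_eq_card_iff : sameArcs ρ B = B.card ↔ ∀ x ∈ B, ρ x ∈ B :=
  Finset.card_filter_eq_iff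

end Statistics

/-! ### Effect of one contraction on the statistics -/

section Transitions

variable {V : Type} [DecidableEq V] {ρ : Perm V} {B W : Finset V}

namespace IsBicolored

variable (h : IsBicolored ρ B W) {b w : V} (hb : b ∈ B) (hw : w ∈ W)

section Boundary

include h hb hw

theorem closedFaces_of_boundary (hX : ρ⁻¹ b ∈ W) (hY : ρ b ∈ B) :
    closedFaces ρ b w = if w = ρ⁻¹ b then 1 else 0 := by
  have h1 := h.notMem_right
  have h2 : ρ (ρ⁻¹ b) = b := by simp
  have inj : ∀ x y, ρ x = ρ y → x = y := fun x y h => ρ.injective h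
  have h3 : ρ b ≠ w := by grind
  have h4 : ρ b ≠ b := by grind
  have h5 : ρ w = b ↔ w = ρ⁻¹ b := by grind
  simp [closedFaces, h3, h4, h5]

/-- Generically the link from `ρ⁻¹ b` to `ρ w` starts at a white point and inherits the type of the
arc leaving `w`. The link from `ρ⁻¹ w` to `ρ b` replaces the black arc leaving `b`, and is black
only if `ρ⁻¹ w` is. -/
theorem sameArcs_of_boundary (hX : ρ⁻¹ b ∈ W) (hY : ρ b ∈ B) :
    sameArcs (_root_.contract ρ b w) (B.erase b) + (if ρ⁻¹ w ∈ W then 1 else 0) =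
      sameArcs ρ B := by
  have h1 := h.notMem_right
  have hXb : ρ (ρ⁻¹ b) = b := by simp
  have hZw : ρ (ρ⁻¹ w) = w := by simp
  have inj : ∀ x y, ρ x = ρ y → x = y := fun x y h => ρ.injective h
  have hbw : b ≠ w := fun e => h.notMem_right b hb (e ▸ hw)
  have hm := h.inv.apply_mem w (Or.inr hw)
  have key : ∀ a ∈ B.erase b, _root_.contract ρ b w a ∈ B.erase b ↔ ρ a ∈ B ∨ a = ρ⁻¹ w := by
    intro a ha
    rw [contract_apply ρ hbw (by grind) (by grind)]
    grind
  have hbm : b ∈ B.filter (ρ · ∈ B) := by simp [hb, hY]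
  have hpos := Finset.card_pos.2 ⟨b, hbm⟩
  have hce := Finset.card_erase_of_mem hbm
  unfold sameArcs
  rw [Finset.filter_congr key]
  split_ifs with hZ
  · have : (B.erase b).filter (fun a => ρ a ∈ B ∨ a = ρ⁻¹ w) = (B.filter (ρ · ∈ B)).erase b := by
      ext a; simp only [Finset.mem_filter, Finset.mem_erase]; grind
    rw [this]; omega
  · have : (B.erase b).filter (fun a => ρ a ∈ B ∨ a = ρ⁻¹ w) =
        insert (ρ⁻¹ w) ((B.filter (ρ · ∈ B)).erase b) := by
      ext a; simp only [Finset.mem_filter, Finset.mem_erase, Finset.mem_insert]; grind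
    rw [this, Finset.card_insert_of_notMem]
    · omega
    · simp only [Finset.mem_filter, Finset.mem_erase]; grind

/-- A new black fixed point can only be `ρ b`, when the link from `ρ⁻¹ w` to `ρ b` closes on itself.
-/
theorem fixedCount_left_of_boundary (hX : ρ⁻¹ b ∈ W) (_ : ρ b ∈ B) :
    fixedCount (_root_.contract ρ b w) (B.erase b) ≤
      fixedCount ρ B + (if w = ρ (ρ b) then 1 else 0) := by
  have h1 := h.notMem_right
  have hXb : ρ (ρ⁻¹ b) = b := by simp
  have inj : ∀ x y, ρ x = ρ y → x = y := fun x y h => ρ.injective h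
  have hbw : b ≠ w := fun e => h.notMem_right b hb (e ▸ hw)
  have : (B.erase b).filter (fun x => _root_.contract ρ b w x = x) ⊆
      (B.filter fun x => ρ x = x) ∪ (if w = ρ (ρ b) then {ρ b} else ∅) := by
    intro a ha
    simp only [Finset.mem_filter, Finset.mem_erase] at ha
    obtain ⟨⟨h2, h3⟩, h4⟩ := ha
    rw [contract_apply ρ hbw h2 (by grind)] at h4
    simp only [Finset.mem_union, Finset.mem_filter]
    grind
  refine (Finset.card_le_card this).trans ((Finset.card_union_le _ _).trans ?_)
  unfold fixedCount
  split_ifs <;> simp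

theorem fixedCount_right_of_boundary (hX : ρ⁻¹ b ∈ W) (hY : ρ b ∈ B) :
    fixedCount (_root_.contract ρ b w) (W.erase w) ≤
      fixedCount ρ W + (if w = ρ⁻¹ (ρ⁻¹ b) then 1 else 0) := by
  have h1 := h.notMem_right
  have hXb : ρ (ρ⁻¹ b) = b := by simp
  have hXX : ρ (ρ⁻¹ (ρ⁻¹ b)) = ρ⁻¹ b := by simp
  have inj : ∀ x y, ρ x = ρ y → x = y := fun x y h => ρ.injective h
  have hbw : b ≠ w := fun e => h.notMem_right b hb (e ▸ hw)
  have : (W.erase w).filter (fun x => _root_.contract ρ b w x = x) ⊆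
      (W.filter fun x => ρ x = x) ∪ (if w = ρ⁻¹ (ρ⁻¹ b) then {ρ⁻¹ b} else ∅) := by
    intro a ha
    simp only [Finset.mem_filter, Finset.mem_erase] at ha
    obtain ⟨⟨h2, h3⟩, h4⟩ := ha
    rw [contract_apply ρ hbw (by grind) h2] at h4
    simp only [Finset.mem_union, Finset.mem_filter]
    grind
  refine (Finset.card_le_card this).trans ((Finset.card_union_le _ _).trans ?_)
  unfold fixedCount
  split_ifs <;> simp

end Boundary

section Alternating

include h hb hw

theorem closedFaces_of_alternating (hX : ρ⁻¹ b ∈ W) (hY : ρ b ∈ W) :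
    closedFaces ρ b w = (if w = ρ⁻¹ b then 1 else 0) + (if w = ρ b then 1 else 0) := by
  have h1 := h.notMem_right
  have h2 : ρ (ρ⁻¹ b) = b := by simp
  have inj : ∀ x y, ρ x = ρ y → x = y := fun x y h => ρ.injective h
  have h4 : ρ b ≠ b := by grind
  have h5 : ρ w = b ↔ w = ρ⁻¹ b := by grind
  have h6 : ρ b = w ↔ w = ρ b := by grind
  simp [closedFaces, h4, h5, h6]

theorem sameArcs_of_alternating (hX : ρ⁻¹ b ∈ W) (hY : ρ b ∈ W) :
    sameArcs (_root_.contract ρ b w) (B.erase b) = sameArcs ρ B := by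
  have h1 := h.notMem_right
  have hXb : ρ (ρ⁻¹ b) = b := by simp
  have inj : ∀ x y, ρ x = ρ y → x = y := fun x y h => ρ.injective h
  have hbw : b ≠ w := fun e => h.notMem_right b hb (e ▸ hw)
  have key : ∀ a ∈ B.erase b, _root_.contract ρ b w a ∈ B.erase b ↔ ρ a ∈ B := by
    intro a ha
    rw [contract_apply ρ hbw (by grind) (by grind)]
    grind
  unfold sameArcs
  rw [Finset.filter_congr key]
  congr 1
  ext a; simp only [Finset.mem_filter, Finset.mem_erase]; grind

theorem fixedCount_left_of_alternating (hX : ρ⁻¹ b ∈ W) (_ : ρ b ∈ W) :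
    fixedCount (_root_.contract ρ b w) (B.erase b) ≤ fixedCount ρ B := by
  have h1 := h.notMem_right
  have hXb : ρ (ρ⁻¹ b) = b := by simp
  have inj : ∀ x y, ρ x = ρ y → x = y := fun x y h => ρ.injective h
  have hbw : b ≠ w := fun e => h.notMem_right b hb (e ▸ hw)
  refine Finset.card_le_card fun a ha => ?_
  simp only [Finset.mem_filter, Finset.mem_erase] at ha ⊢
  obtain ⟨⟨h2, h3⟩, h4⟩ := ha
  rw [contract_apply ρ hbw h2 (by grind)] at h4
  grind

/-- Alternation two steps away from `b` prevents either link from closing on itself at a white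
point. The one other source of a white fixed point needs `w` fixed, and then `ρ⁻¹ b` merely takes
the place of `w`. -/
theorem fixedCount_right_of_alternating (hX : ρ⁻¹ b ∈ W) (hY : ρ b ∈ W)
    (hXX : ρ⁻¹ (ρ⁻¹ b) ∈ B) (hYY : ρ (ρ b) ∈ B) :
    fixedCount (_root_.contract ρ b w) (W.erase w) ≤ fixedCount ρ W := by
  have h1 := h.notMem_right
  have hXb : ρ (ρ⁻¹ b) = b := by simp
  have hXXb : ρ (ρ⁻¹ (ρ⁻¹ b)) = ρ⁻¹ b := by simp
  have inj : ∀ x y, ρ x = ρ y → x = y := fun x y h => ρ.injective h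
  have hbw : b ≠ w := fun e => h.notMem_right b hb (e ▸ hw)
  by_cases hwf : ρ w = w
  · have hwm : w ∈ W.filter fun x => ρ x = x := by simp [hw, hwf]
    have : (W.erase w).filter (fun x => _root_.contract ρ b w x = x) ⊆
        insert (ρ⁻¹ b) ((W.filter fun x => ρ x = x).erase w) := by
      intro a ha
      simp only [Finset.mem_filter, Finset.mem_erase, Finset.mem_insert] at ha ⊢
      obtain ⟨⟨h2, h3⟩, h4⟩ := ha
      rw [contract_apply ρ hbw (by grind) h2] at h4
      grind
    refine (Finset.card_le_card this).trans ((Finset.card_insert_le _ _).trans ?_)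
    rw [Finset.card_erase_of_mem hwm]
    have := Finset.card_pos.2 ⟨w, hwm⟩
    unfold fixedCount
    omega
  · refine Finset.card_le_card fun a ha => ?_
    simp only [Finset.mem_filter, Finset.mem_erase] at ha ⊢
    obtain ⟨⟨h2, h3⟩, h4⟩ := ha
    rw [contract_apply ρ hbw (by grind) h2] at h4
    grind

end Alternating

section Monochromatic

include h hb hw

theorem closedFaces_of_monochromatic (hB : ∀ x ∈ B, ρ x ∈ B) (hbf : ρ b ≠ b) :
    closedFaces ρ b w = 0 := by
  have h1 := h.notMem_right
  have hW := sameArcs_eq_card_iff.1 (h.sameArcs_comm.trans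
    ((sameArcs_eq_card_iff.2 hB).trans h.card_eq))
  have h4 : ρ b ≠ w := by grind
  have h5 : ρ w ≠ b := by grind
  simp [closedFaces, h4, h5, hbf]

/-- If `w` is not fixed, both links join different colours and the two black arcs at `b` are lost.
If `w` is fixed, `b` is simply removed from its cycle. -/
theorem sameArcs_of_monochromatic (hB : ∀ x ∈ B, ρ x ∈ B) (hbf : ρ b ≠ b) :
    sameArcs (_root_.contract ρ b w) (B.erase b) + (if ρ w = w then 1 else 2) = sameArcs ρ B := by
  have h1 := h.notMem_right
  have hW := sameArcs_eq_card_iff.1 (h.sameArcs_comm.trans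
    ((sameArcs_eq_card_iff.2 hB).trans h.card_eq))
  have hXb : ρ (ρ⁻¹ b) = b := by simp
  have inj : ∀ x y, ρ x = ρ y → x = y := fun x y h => ρ.injective h
  have hbw : b ≠ w := fun e => h.notMem_right b hb (e ▸ hw)
  have hXB : ρ⁻¹ b ∈ B := by
    have := h.inv.apply_mem b (Or.inl hb)
    grind
  have hbc := Finset.card_erase_of_mem hb
  have hXm : ρ⁻¹ b ∈ B.erase b := by grind
  have hXc := Finset.card_erase_of_mem hXm
  have hpos := Finset.card_pos.2 ⟨_, hXm⟩
  rw [sameArcs_eq_card_iff.2 hB]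
  unfold sameArcs
  split_ifs with hwf
  · have : (B.erase b).filter (_root_.contract ρ b w · ∈ B.erase b) = B.erase b := by
      refine Finset.filter_true_of_mem fun a ha => ?_
      rw [contract_apply ρ hbw (by grind) (by grind)]
      grind
    rw [this]; omega
  · have : (B.erase b).filter (_root_.contract ρ b w · ∈ B.erase b) =
        (B.erase b).erase (ρ⁻¹ b) := by
      ext a
      rw [Finset.mem_filter, Finset.mem_erase (s := B.erase b), and_comm]
      refine and_congr_left fun ha => ?_
      rw [contract_apply ρ hbw (by grind) (by grind)]
      grind
    rw [this]; omega

theorem fixedCount_left_of_monochromatic (hB : ∀ x ∈ B, ρ x ∈ B) :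
    fixedCount (_root_.contract ρ b w) (B.erase b) ≤
      fixedCount ρ B + (if ρ w = w then 1 else 0) := by
  have h1 := h.notMem_right
  have hW := sameArcs_eq_card_iff.1 (h.sameArcs_comm.trans
    ((sameArcs_eq_card_iff.2 hB).trans h.card_eq))
  have hbw : b ≠ w := fun e => h.notMem_right b hb (e ▸ hw)
  have : (B.erase b).filter (fun x => _root_.contract ρ b w x = x) ⊆
      (B.filter fun x => ρ x = x) ∪ (if ρ w = w then {ρ b} else ∅) := by
    intro a ha
    simp only [Finset.mem_filter, Finset.mem_erase] at ha
    obtain ⟨⟨h2, h3⟩, h4⟩ := ha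
    rw [contract_apply ρ hbw h2 (by grind)] at h4
    simp only [Finset.mem_union, Finset.mem_filter]
    grind
  refine (Finset.card_le_card this).trans ((Finset.card_union_le _ _).trans ?_)
  unfold fixedCount
  split_ifs <;> simp

theorem fixedCount_right_of_monochromatic (hB : ∀ x ∈ B, ρ x ∈ B) (hbf : ρ b ≠ b) :
    fixedCount (_root_.contract ρ b w) (W.erase w) + (if ρ w = w then 1 else 0) ≤
      fixedCount ρ W := by
  have h1 := h.notMem_right
  have hW := sameArcs_eq_card_iff.1 (h.sameArcs_comm.trans
    ((sameArcs_eq_card_iff.2 hB).trans h.card_eq))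
  have hbw : b ≠ w := fun e => h.notMem_right b hb (e ▸ hw)
  have hs : (W.erase w).filter (fun x => _root_.contract ρ b w x = x) ⊆
      (W.filter fun x => ρ x = x).erase w := by
    intro a ha
    simp only [Finset.mem_filter, Finset.mem_erase] at ha ⊢
    obtain ⟨⟨h2, h3⟩, h4⟩ := ha
    rw [contract_apply ρ hbw (by grind) h2] at h4
    grind
  have hle := Finset.card_le_card hs
  unfold fixedCount
  split_ifs with hwf
  · have hwm : w ∈ W.filter fun x => ρ x = x := by simp [hw, hwf]
    have := Finset.card_pos.2 ⟨w, hwm⟩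
    rw [Finset.card_erase_of_mem hwm] at hle
    omega
  · exact hle.trans (Finset.card_le_card (Finset.erase_subset _ _))

end Monochromatic

section Fixed

include h hb hw

theorem closedFaces_of_fixed (hbf : ρ b = b) :
    closedFaces ρ b w = if ρ w = w then 1 else 0 := by
  have hbw : b ≠ w := fun e => h.notMem_right b hb (e ▸ hw)
  have h4 : ρ w ≠ b := fun e => hbw (ρ.injective (hbf.trans e.symm))
  simp [closedFaces, h4, hbf, hbw]

/-- Here contraction just removes `w` from its cycle. The lost loop at `b` is made up for only if
the link from `ρ⁻¹ w` to `ρ w` is black. -/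
theorem sameArcs_of_fixed (hbf : ρ b = b) :
    sameArcs (_root_.contract ρ b w) (B.erase b) +
      (if ρ⁻¹ w ∈ B ∧ ρ w ∈ B then 0 else 1) = sameArcs ρ B := by
  have h1 := h.notMem_right
  have hZw : ρ (ρ⁻¹ w) = w := by simp
  have inj : ∀ x y, ρ x = ρ y → x = y := fun x y h => ρ.injective h
  have hbw : b ≠ w := fun e => h.notMem_right b hb (e ▸ hw)
  have key : ∀ a ∈ B.erase b, _root_.contract ρ b w a ∈ B.erase b ↔
      ρ a ∈ B ∨ (a = ρ⁻¹ w ∧ ρ w ∈ B) := by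
    intro a ha
    rw [contract_apply ρ hbw (by grind) (by grind)]
    grind
  have hbm : b ∈ B.filter (ρ · ∈ B) := by simp [hb, hbf]
  have hpos := Finset.card_pos.2 ⟨b, hbm⟩
  have hce := Finset.card_erase_of_mem hbm
  unfold sameArcs
  rw [Finset.filter_congr key]
  split_ifs with hZ
  · have : (B.erase b).filter (fun a => ρ a ∈ B ∨ (a = ρ⁻¹ w ∧ ρ w ∈ B)) =
        insert (ρ⁻¹ w) ((B.filter (ρ · ∈ B)).erase b) := by
      ext a; simp only [Finset.mem_filter, Finset.mem_erase, Finset.mem_insert]; grind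
    rw [this, Finset.card_insert_of_notMem]
    · omega
    · simp only [Finset.mem_filter, Finset.mem_erase]; grind
  · have : (B.erase b).filter (fun a => ρ a ∈ B ∨ (a = ρ⁻¹ w ∧ ρ w ∈ B)) =
        (B.filter (ρ · ∈ B)).erase b := by
      ext a; simp only [Finset.mem_filter, Finset.mem_erase]; grind
    rw [this]; omega

theorem fixedCount_left_of_fixed (hbf : ρ b = b) :
    fixedCount (_root_.contract ρ b w) (B.erase b) + 1 ≤
      fixedCount ρ B + (if ρ⁻¹ w ∈ B ∧ ρ w ∈ B then 1 else 0) := by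
  have h1 := h.notMem_right
  have hZw : ρ (ρ⁻¹ w) = w := by simp
  have inj : ∀ x y, ρ x = ρ y → x = y := fun x y h => ρ.injective h
  have hbw : b ≠ w := fun e => h.notMem_right b hb (e ▸ hw)
  have hbm : b ∈ B.filter (fun x => ρ x = x) := by simp [hb, hbf]
  have hpos := Finset.card_pos.2 ⟨b, hbm⟩
  have hce := Finset.card_erase_of_mem hbm
  have : (B.erase b).filter (fun x => _root_.contract ρ b w x = x) ⊆
      ((B.filter fun x => ρ x = x).erase b) ∪
        (if ρ⁻¹ w ∈ B ∧ ρ w ∈ B then {ρ w} else ∅) := by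
    intro a ha
    simp only [Finset.mem_filter, Finset.mem_erase] at ha
    obtain ⟨⟨h2, h3⟩, h4⟩ := ha
    rw [contract_apply ρ hbw h2 (by grind)] at h4
    simp only [Finset.mem_union, Finset.mem_filter, Finset.mem_erase]
    grind
  have hle := (Finset.card_le_card this).trans (Finset.card_union_le _ _)
  have : (if ρ⁻¹ w ∈ B ∧ ρ w ∈ B then {ρ w} else (∅ : Finset V)).card =
      if ρ⁻¹ w ∈ B ∧ ρ w ∈ B then 1 else 0 := by split_ifs <;> simp
  unfold fixedCount
  omega

theorem fixedCount_right_of_fixed (hbf : ρ b = b) :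
    fixedCount (_root_.contract ρ b w) (W.erase w) + (if ρ w = w then 1 else 0) ≤
      fixedCount ρ W + (if ρ w ≠ w ∧ ρ⁻¹ w ∈ W ∧ ρ w ∈ W then 1 else 0) := by
  have h1 := h.notMem_right
  have hZw : ρ (ρ⁻¹ w) = w := by simp
  have inj : ∀ x y, ρ x = ρ y → x = y := fun x y h => ρ.injective h
  have hbw : b ≠ w := fun e => h.notMem_right b hb (e ▸ hw)
  have : (W.erase w).filter (fun x => _root_.contract ρ b w x = x) ⊆
      ((W.filter fun x => ρ x = x).erase w) ∪
        (if ρ w ≠ w ∧ ρ⁻¹ w ∈ W ∧ ρ w ∈ W then {ρ w} else ∅) := by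
    intro a ha
    simp only [Finset.mem_filter, Finset.mem_erase] at ha
    obtain ⟨⟨h2, h3⟩, h4⟩ := ha
    rw [contract_apply ρ hbw (by grind) h2] at h4
    simp only [Finset.mem_union, Finset.mem_filter, Finset.mem_erase]
    grind
  have hle := (Finset.card_le_card this).trans (Finset.card_union_le _ _)
  have e1 : (if ρ w ≠ w ∧ ρ⁻¹ w ∈ W ∧ ρ w ∈ W then {ρ w} else (∅ : Finset V)).card =
      if ρ w ≠ w ∧ ρ⁻¹ w ∈ W ∧ ρ w ∈ W then 1 else 0 := by split_ifs <;> simp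
  have e2 : ((W.filter fun x => ρ x = x).erase w).card + (if ρ w = w then 1 else 0) =
      (W.filter fun x => ρ x = x).card := by
    split_ifs with hwf
    · exact Finset.card_erase_add_one (by simp [hw, hwf])
    · rw [Finset.erase_eq_of_notMem (by simp [hwf])]; rfl
  unfold fixedCount
  omega

end Fixed

end IsBicolored

end Transitions

/-! ### Correction weights and the inductive bounds -/

section Weights

/-- The reciprocal of `max m 1`. -/
noncomputable def recip (m : ℕ) : ℝ := 1 / ((max m 1 : ℕ) : ℝ)

theorem recip_of_pos {m : ℕ} (hm : 1 ≤ m) : recip m = 1 / (m : ℝ) := by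
  rw [recip, max_eq_left hm]

theorem recip_nonneg (m : ℕ) : 0 ≤ recip m := by unfold recip; positivity

theorem recip_anti {m n : ℕ} (h : m ≤ n) : recip n ≤ recip m := by
  unfold recip
  apply one_div_le_one_div_of_le
  · exact_mod_cast (by omega : 0 < max m 1)
  · exact_mod_cast max_le_max_right 1 h

theorem harmonic_succ_real (m : ℕ) : (harmonic (m + 1) : ℝ) = harmonic m + 1 / ((m : ℝ) + 1) := by
  rw [harmonic_succ]; push_cast; rw [one_div]

theorem harmonic_pred {m : ℕ} (hm : 1 ≤ m) :
    (harmonic (m - 1) : ℝ) = harmonic m - 1 / (m : ℝ) := by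
  obtain ⟨n, rfl⟩ : ∃ n, m = n + 1 := ⟨m - 1, by omega⟩
  rw [harmonic_succ_real]; push_cast; simp

/-- `0` if both colours have fixed points and there are at least two monochromatic arcs of each
colour, and `1` otherwise. -/
def upperWeight (i j m : ℕ) : ℕ := if 1 ≤ i ∧ 1 ≤ j ∧ 2 ≤ m then 0 else 1

theorem upperWeight_comm (i j m : ℕ) : upperWeight i j m = upperWeight j i m := by
  unfold upperWeight; grind

theorem upperWeight_anti {i j i' j' : ℕ} (hi : i' ≤ i) (hj : j' ≤ j) (m : ℕ) :
    upperWeight i j m ≤ upperWeight i' j' m := by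
  unfold upperWeight; grind

theorem upperWeight_of_left_zero (j m : ℕ) : upperWeight 0 j m = 1 := by simp [upperWeight]

theorem upperWeight_of_lt {m : ℕ} (i j : ℕ) (hm : m < 2) : upperWeight i j m = 1 := by
  unfold upperWeight; grind

/-- `2`, `1` or `0` according to whether the larger of `i` and `j` is at most `2`, is `3`, or is
at least `4`. -/
def lowerWeight (i j : ℕ) : ℕ := 4 - max 2 (max i j)

theorem lowerWeight_comm (i j : ℕ) : lowerWeight i j = lowerWeight j i := by
  rw [lowerWeight, lowerWeight, max_comm i]

theorem lowerWeight_anti {i j i' j' : ℕ} (hi : i' ≤ i) (hj : j' ≤ j) :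
    lowerWeight i j ≤ lowerWeight i' j' := by
  unfold lowerWeight; omega

/-- The upper bound for the mean number of faces with `k` points of each colour, `i` and `j` fixed
points in the two colours, and `m` monochromatic arcs of each colour. -/
noncomputable def upperBound (k i j m : ℕ) : ℝ :=
  2 * (harmonic k : ℝ) - harmonic m + 1 - upperWeight i j m * recip m

/-- The lower bound for the mean number of faces, with the same parameters as `upperBound`. -/
noncomputable def lowerBound (k i j m : ℕ) : ℝ :=
  2 * (harmonic k : ℝ) - harmonic m - 2 + lowerWeight i j * recip m

end Weights

/-! ### Inductive steps for the upper bound -/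

section Steps

variable {V : Type} [Fintype V] [DecidableEq V] {ρ : Perm V} {B W : Finset V} {k : ℕ}

namespace IsBicolored

/-- The increment `2 / (k + 1)` of `2 H`, summed over `k + 1` partners, is the budget `2` for the
gains. -/
theorem meanFaces_le_of_gain (h : IsBicolored ρ B W) (hk : B.card = k + 1) {b : V} (hb : b ∈ B)
    {C : ℝ} (g : V → ℝ)
    (hg : ∀ w ∈ W, (closedFaces ρ b w : ℝ) +
      meanFaces (_root_.contract ρ b w) (B.erase b) (W.erase w) ≤ C - 2 / ((k : ℝ) + 1) + g w)
    (hs : ∑ w ∈ W, g w ≤ 2) : meanFaces ρ B W ≤ C := by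
  have h1 := mul_meanFaces ρ h.disjoint h.card_eq hb
  have h2 := Finset.sum_le_sum hg
  rw [← h1, Finset.sum_add_distrib, Finset.sum_const, nsmul_eq_mul, ← h.card_eq, hk] at h2
  push_cast at h2
  have h3 : (0 : ℝ) < k + 1 := by positivity
  have h4 : ((k : ℝ) + 1) * (C - 2 / ((k : ℝ) + 1)) = (k + 1) * C - 2 := by field_simp
  rw [h4] at h2
  exact le_of_mul_le_mul_left (by linarith) h3

theorem le_meanFaces_of_gain (h : IsBicolored ρ B W) (hk : B.card = k + 1) {b : V} (hb : b ∈ B)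
    {C : ℝ} (g : V → ℝ)
    (hg : ∀ w ∈ W, C - 2 / ((k : ℝ) + 1) + g w ≤ (closedFaces ρ b w : ℝ) +
      meanFaces (_root_.contract ρ b w) (B.erase b) (W.erase w))
    (hs : 2 ≤ ∑ w ∈ W, g w) : C ≤ meanFaces ρ B W := by
  have h1 := mul_meanFaces ρ h.disjoint h.card_eq hb
  have h2 := Finset.sum_le_sum hg
  rw [← h1, Finset.sum_add_distrib, Finset.sum_const, nsmul_eq_mul, ← h.card_eq, hk] at h2
  push_cast at h2
  have h3 : (0 : ℝ) < k + 1 := by positivity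
  have h4 : ((k : ℝ) + 1) * (C - 2 / ((k : ℝ) + 1)) = (k + 1) * C - 2 := by field_simp
  rw [h4] at h2
  exact le_of_mul_le_mul_left (by linarith) h3

theorem sum_indicator_arcs (h : IsBicolored ρ B W) :
    ∑ w ∈ W, ((if ρ⁻¹ w ∈ W then (1 : ℝ) else 0) + (if ρ w ∈ W then 1 else 0)) =
      2 * sameArcs ρ B := by
  rw [Finset.sum_add_distrib, sum_indicator_inv_apply_mem, sum_indicator_apply_mem,
    h.sameArcs_comm]
  ring

section Upper

variable (ih : ∀ (ρ : Perm V) (B W : Finset V), IsBicolored ρ B W → B.card = k →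
  fixedCount ρ B + fixedCount ρ W ≤ 2 →
  meanFaces ρ B W ≤ upperBound k (fixedCount ρ B) (fixedCount ρ W) (sameArcs ρ B))

include ih

/-- The weight decreases in the fixed-point counts, so upper estimates `i'`, `j'` for the new counts
suffice. -/
theorem gain_le_of_contract (h : IsBicolored ρ B W) (hk : B.card = k + 1) {b w : V} (hb : b ∈ B)
    (hw : w ∈ W) {i' j' m' : ℕ} {g : ℝ}
    (hm : sameArcs (_root_.contract ρ b w) (B.erase b) = m')
    (hi : fixedCount (_root_.contract ρ b w) (B.erase b) ≤ i')
    (hj : fixedCount (_root_.contract ρ b w) (W.erase w) ≤ j') (hij : i' + j' ≤ 2)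
    (hg : (closedFaces ρ b w : ℝ) + (harmonic (sameArcs ρ B) - harmonic m') +
      upperWeight (fixedCount ρ B) (fixedCount ρ W) (sameArcs ρ B) * recip (sameArcs ρ B) -
      upperWeight i' j' m' * recip m' ≤ g) :
    (closedFaces ρ b w : ℝ) + meanFaces (_root_.contract ρ b w) (B.erase b) (W.erase w) ≤
      upperBound (k + 1) (fixedCount ρ B) (fixedCount ρ W) (sameArcs ρ B) -
        2 / ((k : ℝ) + 1) + g := by
  have h1 := ih _ _ _ (h.contract hb hw) (by rw [Finset.card_erase_of_mem hb, hk]; rfl)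
    (by omega)
  rw [hm] at h1
  have h2 : (upperWeight i' j' m' : ℝ) * recip m' ≤
      upperWeight (fixedCount (_root_.contract ρ b w) (B.erase b))
        (fixedCount (_root_.contract ρ b w) (W.erase w)) m' * recip m' :=
    mul_le_mul_of_nonneg_right (by exact_mod_cast upperWeight_anti hi hj m') (recip_nonneg _)
  unfold upperBound at *
  rw [harmonic_succ_real]
  have h3 : 2 * ((harmonic k : ℝ) + 1 / ((k : ℝ) + 1)) = 2 * harmonic k + 2 / ((k : ℝ) + 1) := by
    ring
  rw [h3]
  linarith

theorem upper_of_boundary (h : IsBicolored ρ B W) (hk : B.card = k + 1)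
    (hB : fixedCount ρ B = 0) (hW : fixedCount ρ W = 0) {b : V} (hb : b ∈ B)
    (hX : ρ⁻¹ b ∈ W) (hY : ρ b ∈ B) :
    meanFaces ρ B W ≤
      upperBound (k + 1) (fixedCount ρ B) (fixedCount ρ W) (sameArcs ρ B) := by
  set m := sameArcs ρ B with hm
  have hm1 : 1 ≤ m := Finset.card_pos.2 ⟨b, by simp [hb, hY]⟩
  have hmr : (1 : ℝ) ≤ m := by exact_mod_cast hm1
  -- One face closes at `w = ρ⁻¹ b`; `m` partners lower the arc count by one; only `w = ρ (ρ b)` can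
  -- create a black fixed point and so lose the correction.
  refine h.meanFaces_le_of_gain hk hb (fun w => (if w = ρ⁻¹ b then 1 else 0) +
    (if ρ⁻¹ w ∈ W then (1 : ℝ) else 0) * (1 / m + recip m - recip (m - 1)) +
    (if w = ρ (ρ b) then (if 2 ≤ m then recip m else 0) else 0)) ?_ ?_
  · intro w hw
    have e1 := h.sameArcs_of_boundary hb hw hX hY
    have e2 := h.fixedCount_left_of_boundary hb hw hX hY
    have e3 := h.fixedCount_right_of_boundary hb hw hX hY
    have e4 := h.closedFaces_of_boundary hb hw hX hY
    rw [hB] at e2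
    rw [hW] at e3
    rw [← hm] at e1
    by_cases hw2 : w = ρ (ρ b)
    · have hZ : ρ⁻¹ w ∉ W := by
        rw [hw2]; simpa using h.notMem_right _ hY
      rw [if_neg hZ] at e1
      refine h.gain_le_of_contract ih hk hb hw (m' := m) (i' := 1) (j' := 1) e1
        (e2.trans (by split_ifs <;> simp)) (e3.trans (by split_ifs <;> simp)) le_rfl ?_
      rw [← hm, hB, hW, e4, if_neg hZ, if_pos hw2, upperWeight_of_left_zero]
      push_cast
      unfold upperWeight
      split_ifs <;> first | omega | (push_cast; linarith)
    · rw [if_neg hw2] at e2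
      have e1' : sameArcs (_root_.contract ρ b w) (B.erase b) =
        if ρ⁻¹ w ∈ W then m - 1 else m := by split_ifs at e1 ⊢ <;> omega
      refine h.gain_le_of_contract ih hk hb hw (i' := 0) (j' := 1) e1'
        e2 (e3.trans (by split_ifs <;> simp)) (by norm_num) ?_
      rw [← hm, hB, hW, e4, if_neg hw2, upperWeight_of_left_zero, upperWeight_of_left_zero]
      push_cast
      by_cases hZ : ρ⁻¹ w ∈ W
      · simp only [if_pos hZ]
        rw [harmonic_pred hm1]
        linarith
      · simp only [if_neg hZ]
        linarith
  · rw [Finset.sum_add_distrib, Finset.sum_add_distrib, ← Finset.sum_mul,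
      sum_indicator_inv_apply_mem, h.sameArcs_comm, ← hm, Finset.sum_ite_eq', Finset.sum_ite_eq',
      if_pos hX]
    -- The correction improves at the `m` partners that lower the arc count, by `1 / (m - 1)` in
    -- total if `m ≥ 2`; this covers the possible loss `1 / m`.
    have hlast : (if ρ (ρ b) ∈ W then (if 2 ≤ m then recip m else 0) else 0) ≤
        m * (recip (m - 1) - recip m) := by
      by_cases hm2 : 2 ≤ m
      · have hr : (2 : ℝ) ≤ m := by exact_mod_cast hm2
        have h1 : (m : ℝ) * (recip (m - 1) - recip m) = 1 / ((m : ℝ) - 1) := by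
          rw [recip_of_pos hm1, recip_of_pos (by omega : 1 ≤ m - 1), Nat.cast_sub hm1, Nat.cast_one]
          have : (m : ℝ) - 1 ≠ 0 := by linarith
          field_simp
          ring
        rw [h1, if_pos hm2, recip_of_pos hm1]
        have h2 : 1 / (m : ℝ) ≤ 1 / ((m : ℝ) - 1) :=
          one_div_le_one_div_of_le (by linarith) (by linarith)
        have h3 : 0 ≤ 1 / ((m : ℝ) - 1) := one_div_nonneg.2 (by linarith)
        split_ifs <;> assumption
      · rw [if_neg hm2, ite_self]
        exact mul_nonneg (by positivity) (sub_nonneg.2 (recip_anti (by omega)))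
    have h4 : (m : ℝ) * (1 / m + recip m - recip (m - 1)) =
        1 - m * (recip (m - 1) - recip m) := by
      field_simp
      ring
    rw [h4]
    linarith

/-- The statistics do not get worse, and the two faces that can close, at `ρ⁻¹ b` and `ρ b`, use up
the budget exactly. -/
theorem upper_of_alternating (h : IsBicolored ρ B W) (hk : B.card = k + 1)
    (hf : fixedCount ρ B + fixedCount ρ W ≤ 2) {b : V} (hb : b ∈ B)
    (hX : ρ⁻¹ b ∈ W) (hY : ρ b ∈ W) (hXX : ρ⁻¹ (ρ⁻¹ b) ∈ B) (hYY : ρ (ρ b) ∈ B) :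
    meanFaces ρ B W ≤
      upperBound (k + 1) (fixedCount ρ B) (fixedCount ρ W) (sameArcs ρ B) := by
  refine h.meanFaces_le_of_gain hk hb (fun w => (if w = ρ⁻¹ b then 1 else 0) +
    (if w = ρ b then (1 : ℝ) else 0)) ?_ ?_
  · intro w hw
    refine h.gain_le_of_contract ih hk hb hw (h.sameArcs_of_alternating hb hw hX hY)
      (h.fixedCount_left_of_alternating hb hw hX hY)
      (h.fixedCount_right_of_alternating hb hw hX hY hXX hYY) hf ?_
    rw [h.closedFaces_of_alternating hb hw hX hY]
    push_cast
    linarith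
  · rw [Finset.sum_add_distrib, Finset.sum_ite_eq', Finset.sum_ite_eq', if_pos hX, if_pos hY]
    norm_num

theorem upper_of_monochromatic (h : IsBicolored ρ B W) (hk : B.card = k + 1)
    (hB : fixedCount ρ B = 0) (hW : fixedCount ρ W = 0) (hmono : ∀ x ∈ B, ρ x ∈ B) :
    meanFaces ρ B W ≤
      upperBound (k + 1) (fixedCount ρ B) (fixedCount ρ W) (sameArcs ρ B) := by
  obtain ⟨b, hb⟩ : B.Nonempty := Finset.card_pos.1 (by omega)
  have hBf : ∀ x ∈ B, ρ x ≠ x := Finset.filter_eq_empty_iff.1 (Finset.card_eq_zero.1 hB)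
  have hWf : ∀ x ∈ W, ρ x ≠ x := Finset.filter_eq_empty_iff.1 (Finset.card_eq_zero.1 hW)
  have hmc : sameArcs ρ B = B.card := sameArcs_eq_card_iff.2 hmono
  set m := sameArcs ρ B with hm
  have hm2 : 2 ≤ m := by
    rw [hmc]
    exact Finset.one_lt_card.2 ⟨ρ b, hmono b hb, b, hb, hBf b hb⟩
  have hr : (2 : ℝ) ≤ m := by exact_mod_cast hm2
  -- Every partner costs two arcs, a gain `1 / m + 1 / (m - 1)`; the change of the correction
  -- reduces it to at most `2 / m`.
  refine h.meanFaces_le_of_gain hk hb (fun w => 2 / (m : ℝ)) ?_ ?_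
  · intro w hw
    have e1 := h.sameArcs_of_monochromatic hb hw hmono (hBf b hb)
    have e2 := h.fixedCount_left_of_monochromatic hb hw hmono
    have e3 := h.fixedCount_right_of_monochromatic hb hw hmono (hBf b hb)
    rw [if_neg (hWf w hw), ← hm] at e1
    rw [if_neg (hWf w hw), hB] at e2
    rw [if_neg (hWf w hw), hW] at e3
    refine h.gain_le_of_contract ih hk hb hw (m' := m - 1 - 1) (i' := 0) (j' := 0) (by omega)
      e2 e3 (by norm_num) ?_
    rw [← hm, hB, hW, h.closedFaces_of_monochromatic hb hw hmono (hBf b hb),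
      upperWeight_of_left_zero, upperWeight_of_left_zero, harmonic_pred (by omega : 1 ≤ m - 1),
      harmonic_pred (by omega : 1 ≤ m), recip_of_pos (by omega : 1 ≤ m)]
    have h1 := recip_anti (by omega : m - 1 - 1 ≤ m - 1)
    rw [recip_of_pos (by omega : 1 ≤ m - 1)] at h1
    have h2 : 2 / (m : ℝ) = 1 / m + 1 / m := by ring
    push_cast
    rw [h2]
    linarith
  · rw [Finset.sum_const, ← h.card_eq, ← hmc, nsmul_eq_mul]
    have : (m : ℝ) ≠ 0 := by linarith
    field_simp
    exact le_rfl

theorem upper_of_fixed (h : IsBicolored ρ B W) (hk : B.card = k + 1)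
    (hf : fixedCount ρ B + fixedCount ρ W ≤ 2) {b : V} (hb : b ∈ B) (hbf : ρ b = b) :
    meanFaces ρ B W ≤
      upperBound (k + 1) (fixedCount ρ B) (fixedCount ρ W) (sameArcs ρ B) := by
  have hi1 : 1 ≤ fixedCount ρ B := Finset.card_pos.2 ⟨b, by simp [hb, hbf]⟩
  have hmem := h.apply_mem
  have hmem' := h.inv.apply_mem
  have hne := h.notMem_right
  set m := sameArcs ρ B with hm
  have hm1 : 1 ≤ m := hi1.trans (fixedCount_le_sameArcs ρ B)
  have hmr : (1 : ℝ) ≤ m := by exact_mod_cast hm1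
  have hjm : fixedCount ρ W ≤ m := (fixedCount_le_sameArcs ρ W).trans h.sameArcs_comm.le
  -- In the first case the correction is already zero, and only faces closed at white fixed points
  -- need be paid for.
  by_cases hcase : 1 ≤ fixedCount ρ W ∧ 2 ≤ m
  · refine h.meanFaces_le_of_gain hk hb (fun w => if ρ w = w then 1 else 0) ?_ ?_
    · intro w hw
      have e1 := h.sameArcs_of_fixed hb hw hbf
      have e2 := h.fixedCount_left_of_fixed hb hw hbf
      have e3 := h.fixedCount_right_of_fixed hb hw hbf
      have e4 := h.closedFaces_of_fixed hb hw hbf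
      have e5 : upperWeight (fixedCount ρ B) (fixedCount ρ W) m = 0 := by
        unfold upperWeight; rw [if_pos ⟨hi1, hcase⟩]
      rw [← hm] at e1
      by_cases hq : ρ⁻¹ w ∈ B ∧ ρ w ∈ B
      · rw [if_pos hq] at e1 e2
        rw [if_neg (by grind : ¬ (ρ w ≠ w ∧ ρ⁻¹ w ∈ W ∧ ρ w ∈ W))] at e3
        refine h.gain_le_of_contract ih hk hb hw (m' := m) (i' := 1) (j' := 1) e1
          (by omega) (by omega) (by norm_num) ?_
        rw [← hm, e4, e5]
        push_cast
        have := recip_nonneg m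
        have h0 : (0 : ℝ) ≤ upperWeight 1 1 m := by positivity
        nlinarith
      · rw [if_neg hq] at e1 e2
        -- There was exactly one black fixed point, so none remains; the correction returns and
        -- absorbs the lost arc.
        refine h.gain_le_of_contract ih hk hb hw (m' := m - 1) (i' := 0) (j' := 2) (by omega)
          (by omega) (by split_ifs at e3 <;> omega) (by norm_num) ?_
        rw [← hm, e4, e5, harmonic_pred hm1, upperWeight_of_left_zero]
        have h1 := recip_anti (by omega : m - 1 ≤ m)
        rw [recip_of_pos hm1] at h1
        push_cast
        linarith
    · rw [sum_indicator_fixed]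
      exact_mod_cast (by omega : fixedCount ρ W ≤ 2)
  -- Each partner is charged `1 / m` per white neighbour, counting both sides; there are `2 * m`
  -- such incidences.
  · refine h.meanFaces_le_of_gain hk hb (fun w => ((if ρ⁻¹ w ∈ W then (1 : ℝ) else 0) +
      (if ρ w ∈ W then 1 else 0)) / m) ?_ ?_
    · intro w hw
      have e1 := h.sameArcs_of_fixed hb hw hbf
      have e2 := h.fixedCount_left_of_fixed hb hw hbf
      have e3 := h.fixedCount_right_of_fixed hb hw hbf
      have e4 := h.closedFaces_of_fixed hb hw hbf
      have e5 : upperWeight (fixedCount ρ B) (fixedCount ρ W) m = 1 := by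
        unfold upperWeight; rw [if_neg (by tauto)]
      have hr1 := recip_of_pos hm1
      have hr2 := recip_anti (by omega : m - 1 ≤ m)
      rw [hr1] at hr2
      rw [← hm] at e1
      by_cases hq : ρ⁻¹ w ∈ B ∧ ρ w ∈ B
      · rw [if_pos hq] at e1 e2
        rw [if_neg (by grind : ¬ (ρ w ≠ w ∧ ρ⁻¹ w ∈ W ∧ ρ w ∈ W))] at e3
        rw [if_neg (by grind : ¬ ρ w = w)] at e3 e4
        refine h.gain_le_of_contract ih hk hb hw e1 (by omega) (by omega) hf ?_
        rw [← hm, e4, e5, if_neg (hne _ hq.1), if_neg (hne _ hq.2)]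
        simp
      · rw [if_neg hq] at e1 e2
        by_cases hwf : ρ w = w
        · have hj1 : 1 ≤ fixedCount ρ W := Finset.card_pos.2 ⟨w, by simp [hw, hwf]⟩
          -- A white fixed point forces `m = 1` in this case, so the charge `2 / m` pays for the
          -- closed face as well as the lost arc.
          have hmm : m = 1 := by omega
          have hwf' : ρ⁻¹ w = w := by rw [Perm.inv_eq_iff_eq, hwf]
          rw [if_pos hwf] at e4
          rw [if_neg (fun hc => hc.1 hwf : ¬ (ρ w ≠ w ∧ ρ⁻¹ w ∈ W ∧ ρ w ∈ W)), if_pos hwf] at e3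
          refine h.gain_le_of_contract ih hk hb hw (m' := 0) (i' := 1) (j' := 1) (by omega)
            (by omega) (by omega) (by norm_num) ?_
          rw [← hm, e4, e5, upperWeight_of_lt _ _ (by norm_num), hwf, hwf', if_pos hw, hmm]
          norm_num [recip, harmonic_succ]
        · rw [if_neg hwf] at e4 e3
          by_cases hN : ρ⁻¹ w ∈ W ∧ ρ w ∈ W
          · rw [if_pos ⟨hwf, hN⟩] at e3
            refine h.gain_le_of_contract ih hk hb hw (m' := m - 1)
              (i' := fixedCount ρ B - 1) (j' := fixedCount ρ W + 1) (by omega)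
              (by omega) (by omega) (by omega) ?_
            rw [← hm, e4, e5, harmonic_pred hm1, if_pos hN.1, if_pos hN.2, hr1]
            have : 0 ≤ (upperWeight (fixedCount ρ B - 1) (fixedCount ρ W + 1) (m - 1) : ℝ) *
              recip (m - 1) := mul_nonneg (by positivity) (recip_nonneg _)
            push_cast
            have h2 : (1 + 1) / (m : ℝ) = 1 / m + 1 / m := by ring
            rw [h2]
            linarith
          · rw [if_neg (fun hc => hN hc.2 : ¬ (ρ w ≠ w ∧ ρ⁻¹ w ∈ W ∧ ρ w ∈ W))] at e3
            have hw1 : upperWeight (fixedCount ρ B - 1) (fixedCount ρ W) (m - 1) = 1 := by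
              unfold upperWeight; rw [if_neg (by omega)]
            refine h.gain_le_of_contract ih hk hb hw (m' := m - 1)
              (i' := fixedCount ρ B - 1) (j' := fixedCount ρ W) (by omega)
              (by omega) (by omega) (by omega) ?_
            have ha : (if ρ⁻¹ w ∈ W then (1 : ℝ) else 0) + (if ρ w ∈ W then 1 else 0) = 1 := by
              have := hmem w (Or.inr hw)
              have := hmem' w (Or.inr hw)
              split_ifs <;> first | tauto | norm_num
            rw [← hm, e4, e5, harmonic_pred hm1, hw1, ha, hr1]
            push_cast
            linarith
    · rw [← Finset.sum_div, h.sum_indicator_arcs, ← hm]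
      have : (m : ℝ) ≠ 0 := by linarith
      field_simp
      exact le_rfl

end Upper

end IsBicolored

end Steps

/-! ### Inductive steps for the lower bound -/

section LowerSteps

variable {V : Type} [Fintype V] [DecidableEq V] {ρ : Perm V} {B W : Finset V} {k : ℕ}

namespace IsBicolored

variable (ih : ∀ (ρ : Perm V) (B W : Finset V), IsBicolored ρ B W → B.card = k →
  fixedCount ρ B ≤ 1 ∨ fixedCount ρ W ≤ 1 → fixedCount ρ B + fixedCount ρ W ≤ 4 →
  lowerBound k (fixedCount ρ B) (fixedCount ρ W) (sameArcs ρ B) ≤ meanFaces ρ B W)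

include ih

theorem le_gain_of_contract (h : IsBicolored ρ B W) (hk : B.card = k + 1) {b w : V} (hb : b ∈ B)
    (hw : w ∈ W) {i' j' m' : ℕ} {g : ℝ}
    (hm : sameArcs (_root_.contract ρ b w) (B.erase b) = m')
    (hi : fixedCount (_root_.contract ρ b w) (B.erase b) ≤ i')
    (hj : fixedCount (_root_.contract ρ b w) (W.erase w) ≤ j')
    (hmin : i' ≤ 1 ∨ j' ≤ 1) (hij : i' + j' ≤ 4)
    (hg : g ≤ (closedFaces ρ b w : ℝ) + (harmonic (sameArcs ρ B) - harmonic m') -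
      lowerWeight (fixedCount ρ B) (fixedCount ρ W) * recip (sameArcs ρ B) +
      lowerWeight i' j' * recip m') :
    lowerBound (k + 1) (fixedCount ρ B) (fixedCount ρ W) (sameArcs ρ B) -
        2 / ((k : ℝ) + 1) + g ≤
      (closedFaces ρ b w : ℝ) + meanFaces (_root_.contract ρ b w) (B.erase b) (W.erase w) := by
  have h1 := ih _ _ _ (h.contract hb hw) (by rw [Finset.card_erase_of_mem hb, hk]; rfl)
    (by omega) (by omega)
  rw [hm] at h1
  have h2 : (lowerWeight i' j' : ℝ) * recip m' ≤
      lowerWeight (fixedCount (_root_.contract ρ b w) (B.erase b))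
        (fixedCount (_root_.contract ρ b w) (W.erase w)) * recip m' :=
    mul_le_mul_of_nonneg_right (by exact_mod_cast lowerWeight_anti hi hj) (recip_nonneg _)
  unfold lowerBound at *
  rw [harmonic_succ_real]
  have h3 : 2 * ((harmonic k : ℝ) + 1 / ((k : ℝ) + 1)) = 2 * harmonic k + 2 / ((k : ℝ) + 1) := by
    ring
  rw [h3]
  linarith

theorem lower_of_alternating (h : IsBicolored ρ B W) (hk : B.card = k + 1)
    (hmin : fixedCount ρ B ≤ 1 ∨ fixedCount ρ W ≤ 1)
    (hf : fixedCount ρ B + fixedCount ρ W ≤ 4) {b : V} (hb : b ∈ B)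
    (hX : ρ⁻¹ b ∈ W) (hY : ρ b ∈ W) (hXX : ρ⁻¹ (ρ⁻¹ b) ∈ B) (hYY : ρ (ρ b) ∈ B) :
    lowerBound (k + 1) (fixedCount ρ B) (fixedCount ρ W) (sameArcs ρ B) ≤ meanFaces ρ B W := by
  refine h.le_meanFaces_of_gain hk hb (fun w => (if w = ρ⁻¹ b then 1 else 0) +
    (if w = ρ b then (1 : ℝ) else 0)) ?_ ?_
  · intro w hw
    refine h.le_gain_of_contract ih hk hb hw (h.sameArcs_of_alternating hb hw hX hY)
      (h.fixedCount_left_of_alternating hb hw hX hY)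
      (h.fixedCount_right_of_alternating hb hw hX hY hXX hYY) hmin hf ?_
    rw [h.closedFaces_of_alternating hb hw hX hY]
    push_cast
    linarith
  · rw [Finset.sum_add_distrib, Finset.sum_ite_eq', Finset.sum_ite_eq', if_pos hX, if_pos hY]
    norm_num

theorem lower_of_boundary (h : IsBicolored ρ B W) (hk : B.card = k + 1)
    (hmin : fixedCount ρ B = 0 ∨ fixedCount ρ W = 0)
    (hB : fixedCount ρ B ≤ 2) (hW : fixedCount ρ W ≤ 2) {b : V} (hb : b ∈ B)
    (hX : ρ⁻¹ b ∈ W) (hY : ρ b ∈ B) :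
    lowerBound (k + 1) (fixedCount ρ B) (fixedCount ρ W) (sameArcs ρ B) ≤ meanFaces ρ B W := by
  have hBm := fixedCount_le_sameArcs ρ B
  have hWm := (fixedCount_le_sameArcs ρ W).trans h.sameArcs_comm.le
  set i := fixedCount ρ B with hi
  set j := fixedCount ρ W with hj
  set m := sameArcs ρ B with hm
  have hm1 : 1 ≤ m := Finset.card_pos.2 ⟨b, by simp [hb, hY]⟩
  have hmr : (1 : ℝ) ≤ m := by exact_mod_cast hm1
  have hlw : lowerWeight i j = 2 := by unfold lowerWeight; omega
  -- The weight drops below `2` only when a count rises from `2` to `3`. At most one colour has two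
  -- fixed points, so there is at most one exceptional partner, charged `1 / (m - 1)`.
  refine h.le_meanFaces_of_gain hk hb (fun w => (if w = ρ⁻¹ b then 1 else 0) +
    (if ρ⁻¹ w ∈ W then (1 : ℝ) else 0) * (1 / m + 2 * recip (m - 1) - 2 * recip m) -
    (if w = (if j = 2 then ρ⁻¹ (ρ⁻¹ b) else ρ (ρ b)) then
      (if 2 ≤ m then recip (m - 1) else 0) else 0)) ?_ ?_
  · intro w hw
    have e1 := h.sameArcs_of_boundary hb hw hX hY
    have e2 := h.fixedCount_left_of_boundary hb hw hX hY
    have e3 := h.fixedCount_right_of_boundary hb hw hX hY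
    have e4 := h.closedFaces_of_boundary hb hw hX hY
    rw [← hi] at e2
    rw [← hj] at e3
    rw [← hm] at e1
    have e1' : sameArcs (_root_.contract ρ b w) (B.erase b) =
      if ρ⁻¹ w ∈ W then m - 1 else m := by split_ifs at e1 ⊢ <;> omega
    have hle : recip m ≤ recip (m - 1) := recip_anti (by omega)
    refine h.le_gain_of_contract ih hk hb hw e1' e2 e3
      (by split_ifs <;> omega) (by split_ifs <;> omega) ?_
    rw [← hm, ← hi, ← hj, e4, hlw]
    by_cases hspecial : w = (if j = 2 then ρ⁻¹ (ρ⁻¹ b) else ρ (ρ b)) ∧ 2 ≤ m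
    · rw [if_pos hspecial.1, if_pos hspecial.2]
      have h1 : 1 ≤ lowerWeight (i + if w = ρ (ρ b) then 1 else 0)
          (j + if w = ρ⁻¹ (ρ⁻¹ b) then 1 else 0) := by
        unfold lowerWeight; split_ifs <;> omega
      have h1' : (1 : ℝ) ≤ lowerWeight (i + if w = ρ (ρ b) then 1 else 0)
          (j + if w = ρ⁻¹ (ρ⁻¹ b) then 1 else 0) := by exact_mod_cast h1
      have h2 := mul_le_mul_of_nonneg_right h1'
        (recip_nonneg (if ρ⁻¹ w ∈ W then m - 1 else m))
      by_cases hZ : ρ⁻¹ w ∈ W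
      · simp only [if_pos hZ] at h2 ⊢
        rw [harmonic_pred hm1]
        push_cast
        linarith
      · simp only [if_neg hZ] at h2 ⊢
        push_cast
        have := recip_nonneg m
        linarith
    · have h0 : (if w = (if j = 2 then ρ⁻¹ (ρ⁻¹ b) else ρ (ρ b)) then
          (if 2 ≤ m then recip (m - 1) else 0) else 0) = 0 := by
        rw [ite_eq_right_iff]
        exact fun h1 => if_neg fun h2 => hspecial ⟨h1, h2⟩
      have h1 : lowerWeight (i + if w = ρ (ρ b) then 1 else 0)
          (j + if w = ρ⁻¹ (ρ⁻¹ b) then 1 else 0) = 2 := by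
        unfold lowerWeight
        split_ifs at hspecial ⊢ <;> first | omega | grind
      rw [h0, h1]
      by_cases hZ : ρ⁻¹ w ∈ W
      · simp only [if_pos hZ]
        rw [harmonic_pred hm1]
        push_cast
        linarith
      · simp only [if_neg hZ]
        push_cast
        linarith
  · rw [Finset.sum_sub_distrib, Finset.sum_add_distrib, ← Finset.sum_mul,
      sum_indicator_inv_apply_mem, h.sameArcs_comm, ← hm, Finset.sum_ite_eq', Finset.sum_ite_eq',
      if_pos hX]
    generalize (if j = 2 then ρ⁻¹ (ρ⁻¹ b) else ρ (ρ b)) = x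
    -- For `m ≥ 2` the growth of the correction yields `2 / (m - 1)` in total, twice the exceptional
    -- charge.
    have hlast : (if x ∈ W then (if 2 ≤ m then recip (m - 1) else 0) else 0) ≤
        2 * m * (recip (m - 1) - recip m) := by
      by_cases hm2 : 2 ≤ m
      · have hr : (2 : ℝ) ≤ m := by exact_mod_cast hm2
        have h1 : 2 * (m : ℝ) * (recip (m - 1) - recip m) = 2 * recip (m - 1) := by
          rw [recip_of_pos hm1, recip_of_pos (by omega : 1 ≤ m - 1), Nat.cast_sub hm1, Nat.cast_one]
          have : (m : ℝ) - 1 ≠ 0 := by linarith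
          field_simp
          ring
        rw [h1, if_pos hm2]
        have := recip_nonneg (m - 1)
        split_ifs <;> linarith
      · rw [if_neg hm2, ite_self]
        exact mul_nonneg (by positivity) (sub_nonneg.2 (recip_anti (by omega)))
    have h4 : (m : ℝ) * (1 / m + 2 * recip (m - 1) - 2 * recip m) =
        1 + 2 * m * (recip (m - 1) - recip m) := by
      field_simp
      ring
    rw [h4]
    linarith

theorem lower_of_monochromatic (h : IsBicolored ρ B W) (hk : B.card = k + 1)
    (hB : fixedCount ρ B = 0) (hW : fixedCount ρ W ≤ 2) (hmono : ∀ x ∈ B, ρ x ∈ B) :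
    lowerBound (k + 1) (fixedCount ρ B) (fixedCount ρ W) (sameArcs ρ B) ≤ meanFaces ρ B W := by
  obtain ⟨b, hb⟩ : B.Nonempty := Finset.card_pos.1 (by omega)
  have hBf : ∀ x ∈ B, ρ x ≠ x := Finset.filter_eq_empty_iff.1 (Finset.card_eq_zero.1 hB)
  have hmc : sameArcs ρ B = B.card := sameArcs_eq_card_iff.2 hmono
  set j := fixedCount ρ W with hj
  set m := sameArcs ρ B with hm
  have hm2 : 2 ≤ m := by
    rw [hmc]
    exact Finset.one_lt_card.2 ⟨ρ b, hmono b hb, b, hb, hBf b hb⟩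
  have hr : (2 : ℝ) ≤ m := by exact_mod_cast hm2
  have hlw : lowerWeight 0 j = 2 := by unfold lowerWeight; omega
  have hr1 := recip_of_pos (by omega : 1 ≤ m)
  have hr2 := recip_of_pos (by omega : 1 ≤ m - 1)
  -- A fixed `w` costs one arc instead of two, hence the last term. The total exceeds `2` by `(3 -
  -- j) / (m - 1)`, which is nonnegative as `j ≤ 2`.
  refine h.le_meanFaces_of_gain hk hb (fun w => 3 * recip (m - 1) - 1 / (m : ℝ) -
    (if ρ w = w then (1 : ℝ) else 0) * recip (m - 1)) ?_ ?_
  · intro w hw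
    have e1 := h.sameArcs_of_monochromatic hb hw hmono (hBf b hb)
    have e2 := h.fixedCount_left_of_monochromatic hb hw hmono
    have e3 := h.fixedCount_right_of_monochromatic hb hw hmono (hBf b hb)
    have e4 := h.closedFaces_of_monochromatic hb hw hmono (hBf b hb)
    rw [← hm] at e1
    rw [hB] at e2
    rw [← hj] at e3
    by_cases hwf : ρ w = w
    · rw [if_pos hwf] at e1 e2 e3
      refine h.le_gain_of_contract ih hk hb hw (m' := m - 1) (i' := 1) (j' := j) (by omega)
        e2 (by omega) (by omega) (by omega) ?_
      have hlw' : lowerWeight 1 j = 2 := by unfold lowerWeight; omega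
      rw [← hm, ← hj, hB, e4, hlw, hlw', if_pos hwf, harmonic_pred (by omega), hr1]
      push_cast
      linarith
    · rw [if_neg hwf] at e1 e2 e3
      refine h.le_gain_of_contract ih hk hb hw (m' := m - 1 - 1) (i' := 0) (j' := j) (by omega)
        e2 (by omega) (by omega) (by omega) ?_
      have h1 := recip_anti (by omega : m - 1 - 1 ≤ m - 1)
      rw [← hm, ← hj, hB, e4, hlw, if_neg hwf, harmonic_pred (by omega : 1 ≤ m - 1),
        harmonic_pred (by omega : 1 ≤ m), hr1, ← hr2]
      push_cast
      linarith
  · rw [Finset.sum_sub_distrib, Finset.sum_const, ← Finset.sum_mul, sum_indicator_fixed,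
      ← h.card_eq, ← hmc, nsmul_eq_mul, ← hj, hr2, Nat.cast_sub (by omega : 1 ≤ m), Nat.cast_one]
    have hjr : (j : ℝ) ≤ 2 := by exact_mod_cast hW
    have h1 : (0 : ℝ) < (m : ℝ) - 1 := by linarith
    have h2 : (m : ℝ) * (3 * (1 / ((m : ℝ) - 1)) - 1 / m) - j * (1 / ((m : ℝ) - 1)) =
        2 + (3 - j) / ((m : ℝ) - 1) := by
      have : (m : ℝ) ≠ 0 := by linarith
      field_simp
      ring
    rw [h2]
    have : 0 ≤ (3 - (j : ℝ)) / ((m : ℝ) - 1) := div_nonneg (by linarith) h1.le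
    linarith

theorem lower_of_fixed (h : IsBicolored ρ B W) (hk : B.card = k + 1)
    (hf : (fixedCount ρ B = 1 ∧ 1 ≤ fixedCount ρ W ∧ fixedCount ρ W ≤ 3) ∨
      (3 ≤ fixedCount ρ B ∧ fixedCount ρ B ≤ 4 ∧ fixedCount ρ W = 0))
    {b : V} (hb : b ∈ B) (hbf : ρ b = b) :
    lowerBound (k + 1) (fixedCount ρ B) (fixedCount ρ W) (sameArcs ρ B) ≤ meanFaces ρ B W := by
  have hne := h.notMem_right
  have hBm := fixedCount_le_sameArcs ρ B
  set i := fixedCount ρ B with hi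
  set j := fixedCount ρ W with hj
  set m := sameArcs ρ B with hm
  have hm1 : 1 ≤ m := by omega
  have hmr : (1 : ℝ) ≤ m := by exact_mod_cast hm1
  have hr1 := recip_of_pos hm1
  have hr2 := recip_anti (by omega : m - 1 ≤ m)
  -- White-neighbour incidences contribute `2`. The surplus at the `j` white fixed points, where
  -- faces close, pays for removing a `w` inside a white run, which may create a white fixed point.
  refine h.le_meanFaces_of_gain hk hb (fun w => ((if ρ⁻¹ w ∈ W then (1 : ℝ) else 0) +
      (if ρ w ∈ W then 1 else 0)) * recip m + (if ρ w = w then (1 : ℝ) else 0) * (1 - recip m) -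
      (if ρ w ≠ w ∧ ρ⁻¹ w ∈ W ∧ ρ w ∈ W then (1 : ℝ) else 0) * (j * recip m)) ?_ ?_
  · intro w hw
    have e1 := h.sameArcs_of_fixed hb hw hbf
    have e2 := h.fixedCount_left_of_fixed hb hw hbf
    have e3 := h.fixedCount_right_of_fixed hb hw hbf
    have e4 := h.closedFaces_of_fixed hb hw hbf
    rw [← hm] at e1
    rw [← hi] at e2
    rw [← hj] at e3
    by_cases hq : ρ⁻¹ w ∈ B ∧ ρ w ∈ B
    · have hN : ¬ (ρ w ≠ w ∧ ρ⁻¹ w ∈ W ∧ ρ w ∈ W) := fun hc => hne _ hq.1 hc.2.1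
      have hwf : ¬ ρ w = w := fun hc => hne _ hq.2 (by rwa [hc])
      rw [if_pos hq] at e1 e2
      rw [if_neg hN, if_neg hwf] at e3
      rw [if_neg hwf] at e4
      refine h.le_gain_of_contract ih hk hb hw (m' := m) (i' := i) (j' := j) e1 (by omega)
        (by omega) (by omega) (by omega) ?_
      rw [← hm, ← hi, ← hj, e4, if_neg hN, if_neg hwf, if_neg (hne _ hq.1), if_neg (hne _ hq.2)]
      simp
    · rw [if_neg hq] at e1 e2
      have gain : ∀ (i' j' : ℕ) (c : ℝ), c + lowerWeight i j ≤ 1 + lowerWeight i' j' →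
          c * recip m ≤ (harmonic m : ℝ) - harmonic (m - 1) - lowerWeight i j * recip m +
            lowerWeight i' j' * recip (m - 1) := by
        intro i' j' c hc
        rw [harmonic_pred hm1, ← hr1]
        have h1 := mul_le_mul_of_nonneg_right hc (recip_nonneg m)
        have h2 := mul_le_mul_of_nonneg_left hr2 (by positivity : (0 : ℝ) ≤ lowerWeight i' j')
        linarith
      by_cases hwf : ρ w = w
      · have hU : ρ w ∈ W := by rwa [hwf]
        have hZ : ρ⁻¹ w ∈ W := by rwa [(Perm.inv_eq_iff_eq.2 hwf.symm : ρ⁻¹ w = w)]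
        have hN : ¬ (ρ w ≠ w ∧ ρ⁻¹ w ∈ W ∧ ρ w ∈ W) := fun hc => hc.1 hwf
        rw [if_neg hN, if_pos hwf] at e3
        rw [if_pos hwf] at e4
        refine h.le_gain_of_contract ih hk hb hw (m' := m - 1) (i' := i - 1) (j' := j) (by omega)
          (by omega) (by omega) (by omega) (by omega) ?_
        have hlw : lowerWeight i j ≤ lowerWeight (i - 1) j := lowerWeight_anti (by omega) le_rfl
        have hlw' : (lowerWeight i j : ℝ) ≤ lowerWeight (i - 1) j := by exact_mod_cast hlw
        have := gain (i - 1) j 1 (by linarith)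
        rw [← hm, ← hi, ← hj, e4, if_neg hN, if_pos hwf, if_pos hZ, if_pos hU]
        push_cast
        linarith
      · rw [if_neg hwf] at e3 e4
        by_cases hN : ρ⁻¹ w ∈ W ∧ ρ w ∈ W
        · have hN' : ρ w ≠ w ∧ ρ⁻¹ w ∈ W ∧ ρ w ∈ W := ⟨hwf, hN⟩
          rw [if_pos hN'] at e3
          refine h.le_gain_of_contract ih hk hb hw (m' := m - 1) (i' := i - 1) (j' := j + 1)
            (by omega) (by omega) (by omega) (by omega) (by omega) ?_
          -- This inequality dictates the admissible pairs: it fails for `j = 0` and `i` equal to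
          -- `1` or `2`.
          have hlw : 1 + lowerWeight i j ≤ j + lowerWeight (i - 1) (j + 1) := by
            unfold lowerWeight; omega
          have hlw' : (1 : ℝ) + lowerWeight i j ≤ j + lowerWeight (i - 1) (j + 1) := by
            exact_mod_cast hlw
          have := gain (i - 1) (j + 1) (2 - j) (by linarith)
          rw [← hm, ← hi, ← hj, e4, if_pos hN', if_neg hwf, if_pos hN.1, if_pos hN.2]
          push_cast
          linarith
        · have hN' : ¬ (ρ w ≠ w ∧ ρ⁻¹ w ∈ W ∧ ρ w ∈ W) := fun hc => hN hc.2
          rw [if_neg hN'] at e3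
          refine h.le_gain_of_contract ih hk hb hw (m' := m - 1) (i' := i - 1) (j' := j)
            (by omega) (by omega) (by omega) (by omega) (by omega) ?_
          have hlw : lowerWeight i j ≤ lowerWeight (i - 1) j := lowerWeight_anti (by omega) le_rfl
          have hlw' : (lowerWeight i j : ℝ) ≤ lowerWeight (i - 1) j := by exact_mod_cast hlw
          have := gain (i - 1) j 1 (by linarith)
          have ha : (if ρ⁻¹ w ∈ W then (1 : ℝ) else 0) + (if ρ w ∈ W then 1 else 0) ≤ 1 := by
            by_cases h1 : ρ⁻¹ w ∈ W
            · rw [if_pos h1, if_neg fun h2 => hN ⟨h1, h2⟩, add_zero]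
            · rw [if_neg h1]; split_ifs <;> norm_num
          have ha' := mul_le_mul_of_nonneg_right ha (recip_nonneg m)
          rw [← hm, ← hi, ← hj, e4, if_neg hN', if_neg hwf]
          push_cast
          linarith
  · rw [Finset.sum_sub_distrib, Finset.sum_add_distrib, ← Finset.sum_mul, ← Finset.sum_mul,
      ← Finset.sum_mul, h.sum_indicator_arcs, sum_indicator_fixed, ← hm, ← hj]
    -- White fixed points and interior points of white runs are disjoint sets of points with a white
    -- successor.
    have hcount : ∑ w ∈ W, (if ρ w ≠ w ∧ ρ⁻¹ w ∈ W ∧ ρ w ∈ W then (1 : ℝ) else 0) + j ≤ m := by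
      rw [hj, ← sum_indicator_fixed, ← Finset.sum_add_distrib, hm, ← h.sameArcs_comm,
        ← sum_indicator_apply_mem]
      refine Finset.sum_le_sum fun w hw => ?_
      by_cases hwf : ρ w = w
      · simp [hwf, hw]
      · by_cases hwW : ρ w ∈ W
        · simp only [if_pos hwW, if_neg hwf]
          split_ifs <;> norm_num
        · simp [hwf, hwW]
    set N := ∑ w ∈ W, (if ρ w ≠ w ∧ ρ⁻¹ w ∈ W ∧ ρ w ∈ W then (1 : ℝ) else 0)
    have hmrecip : (m : ℝ) * recip m = 1 := by rw [hr1]; field_simp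
    have hj0 : (0 : ℝ) ≤ j := by positivity
    have hjj : (j : ℝ) ≤ j * j := by exact_mod_cast Nat.le_mul_self j
    have h1 := mul_le_mul_of_nonneg_right (mul_le_mul_of_nonneg_left hcount hj0) (recip_nonneg m)
    have h2 := mul_le_mul_of_nonneg_right hjj (recip_nonneg m)
    have h3 : (j : ℝ) * m * recip m = j := by rw [mul_assoc, hmrecip, mul_one]
    have h4 : 2 * (m : ℝ) * recip m = 2 := by rw [mul_assoc, hmrecip, mul_one]
    rw [h3] at h1
    rw [h4]
    have h5 : (j : ℝ) * (N + j) * recip m = N * (j * recip m) + j * j * recip m := by ring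
    rw [h5] at h1
    linarith

end IsBicolored

end LowerSteps

/-! ### The two inductions -/

section Induction

variable {V : Type} [Fintype V] [DecidableEq V]

theorem cycleCount_one : cycleCount (1 : Perm V) = Fintype.card V := by
  rw [cycleCount, ← Nat.card_eq_fintype_card]
  refine Nat.card_congr (Equiv.ofBijective (Quotient.mk _) ⟨fun a b hab => ?_,
    Quotient.mk_surjective⟩).symm
  have h : SameCycle (1 : Perm V) a b := Quotient.exact hab
  exact sameCycle_one.1 h

theorem IsBicolored.meanFaces_of_card_eq_zero {ρ : Perm V} {B W : Finset V}
    (h : IsBicolored ρ B W) (hk : B.card = 0) :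
    meanFaces ρ B W = 0 ∧ fixedCount ρ B = 0 ∧ fixedCount ρ W = 0 ∧ sameArcs ρ B = 0 := by
  have hB : B = ∅ := Finset.card_eq_zero.1 hk
  have hW : W = ∅ := Finset.card_eq_zero.1 (h.card_eq ▸ hk)
  subst hB hW
  have hρ : ρ = 1 := by
    ext x
    exact h.apply_eq x (by simp) (by simp)
  have hmat : matchings (∅ : Finset V) ∅ = {1} := by
    ext ι
    simp only [mem_matchings, Finset.mem_singleton]
    constructor
    · rintro ⟨-, -, -, hι⟩
      ext x
      exact hι x (by simp) (by simp)
    · rintro rfl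
      simp
  refine ⟨?_, rfl, rfl, rfl⟩
  rw [meanFaces, hmat, hρ]
  simp [cycleCount_one]

/-- Unless all points are mapped to points of their own colour, some cycle has a monochromatic arc
next to a two-coloured one, or some cycle alternates between the colours. -/
theorem IsBicolored.exists_boundary_or_alternating {ρ : Perm V} {B W : Finset V}
    (h : IsBicolored ρ B W) (hmono : ¬ ∀ x ∈ B, ρ x ∈ B) :
    (∃ b ∈ B, ρ⁻¹ b ∈ W ∧ ρ b ∈ B) ∨ (∃ b ∈ B, ρ b ∈ W ∧ ρ⁻¹ b ∈ B) ∨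
    (∃ w ∈ W, ρ⁻¹ w ∈ B ∧ ρ w ∈ W) ∨ (∃ w ∈ W, ρ w ∈ B ∧ ρ⁻¹ w ∈ W) ∨
    ∃ b ∈ B, ρ⁻¹ b ∈ W ∧ ρ b ∈ W ∧ ρ⁻¹ (ρ⁻¹ b) ∈ B ∧ ρ (ρ b) ∈ B := by
  push Not at hmono
  obtain ⟨b, hb, hbB⟩ := hmono
  have hm := h.apply_mem
  have hm' := h.inv.apply_mem
  have h1 : ρ b ∈ W := (hm b (Or.inl hb)).resolve_left hbB
  have e1 : ρ⁻¹ (ρ b) = b := by simp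
  have e2 : ρ (ρ⁻¹ b) = b := by simp
  by_cases h2 : ρ⁻¹ b ∈ B
  · exact Or.inr (Or.inl ⟨b, hb, h1, h2⟩)
  have h3 : ρ⁻¹ b ∈ W := (hm' b (Or.inl hb)).resolve_left h2
  by_cases h4 : ρ (ρ b) ∈ W
  · exact Or.inr (Or.inr (Or.inl ⟨ρ b, h1, by rwa [e1], h4⟩))
  have h5 : ρ (ρ b) ∈ B := (hm _ (Or.inr h1)).resolve_right h4
  by_cases h6 : ρ⁻¹ (ρ⁻¹ b) ∈ W
  · exact Or.inr (Or.inr (Or.inr (Or.inl ⟨ρ⁻¹ b, h3, by rwa [e2], h6⟩)))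
  have h7 : ρ⁻¹ (ρ⁻¹ b) ∈ B := (hm' _ (Or.inr h3)).resolve_right h6
  exact Or.inr (Or.inr (Or.inr (Or.inr ⟨b, hb, h3, h1, h7, h5⟩)))

theorem exists_fixed_of_pos {ρ : Perm V} {B : Finset V} (h : 1 ≤ fixedCount ρ B) :
    ∃ b ∈ B, ρ b = b := by
  obtain ⟨b, hb⟩ := Finset.card_pos.1 h
  exact ⟨b, (Finset.mem_filter.1 hb).1, (Finset.mem_filter.1 hb).2⟩

theorem upperBound_comm (k i j m : ℕ) : upperBound k i j m = upperBound k j i m := by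
  rw [upperBound, upperBound, upperWeight_comm]

theorem lowerBound_comm (k i j m : ℕ) : lowerBound k i j m = lowerBound k j i m := by
  rw [lowerBound, lowerBound, lowerWeight_comm]

theorem meanFaces_le_upperBound (k : ℕ) : ∀ (ρ : Perm V) (B W : Finset V), IsBicolored ρ B W →
    B.card = k → fixedCount ρ B + fixedCount ρ W ≤ 2 →
    meanFaces ρ B W ≤ upperBound k (fixedCount ρ B) (fixedCount ρ W) (sameArcs ρ B) := by
  induction k with
  | zero =>
    intro ρ B W h hk _
    obtain ⟨h1, h2, h3, h4⟩ := h.meanFaces_of_card_eq_zero hk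
    rw [h1, h2, h3, h4]
    -- The convention `recip 0 = 1` makes the bound exactly `0` here, and likewise for the lower
    -- bound.
    simp [upperBound, upperWeight, recip]
  | succ k ih =>
    intro ρ B W h hk hf
    have hkW : W.card = k + 1 := h.card_eq ▸ hk
    by_cases hB : 1 ≤ fixedCount ρ B
    · obtain ⟨b, hb, hbf⟩ := exists_fixed_of_pos hB
      exact h.upper_of_fixed ih hk hf hb hbf
    by_cases hW : 1 ≤ fixedCount ρ W
    · obtain ⟨b, hb, hbf⟩ := exists_fixed_of_pos hW
      have := h.symm.upper_of_fixed ih hkW (by omega) hb hbf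
      rwa [meanFaces_comm ρ h.symm.card_eq, h.sameArcs_comm, upperBound_comm] at this
    have hB0 : fixedCount ρ B = 0 := by omega
    have hW0 : fixedCount ρ W = 0 := by omega
    by_cases hmono : ∀ x ∈ B, ρ x ∈ B
    · exact h.upper_of_monochromatic ih hk hB0 hW0 hmono
    rcases h.exists_boundary_or_alternating hmono with ⟨b, hb, h1, h2⟩ | ⟨b, hb, h1, h2⟩ |
      ⟨b, hb, h1, h2⟩ | ⟨b, hb, h1, h2⟩ | ⟨b, hb, h1, h2, h3, h4⟩
    · exact h.upper_of_boundary ih hk hB0 hW0 hb h1 h2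
    · have := h.inv.upper_of_boundary ih hk (by rwa [fixedCount_inv]) (by rwa [fixedCount_inv]) hb
        (by rwa [inv_inv]) h2
      rwa [meanFaces_inv, fixedCount_inv, fixedCount_inv, sameArcs_inv] at this
    · have := h.symm.upper_of_boundary ih hkW hW0 hB0 hb h1 h2
      rwa [meanFaces_comm ρ h.symm.card_eq, h.sameArcs_comm, upperBound_comm] at this
    · have := h.inv.symm.upper_of_boundary ih hkW (by rwa [fixedCount_inv])
        (by rwa [fixedCount_inv]) hb (by rwa [inv_inv]) h2
      rwa [meanFaces_inv, fixedCount_inv, fixedCount_inv, sameArcs_inv,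
        meanFaces_comm ρ h.symm.card_eq, h.sameArcs_comm, upperBound_comm] at this
    · exact h.upper_of_alternating ih hk hf hb h1 h2 h3 h4

theorem lowerBound_le_meanFaces (k : ℕ) : ∀ (ρ : Perm V) (B W : Finset V), IsBicolored ρ B W →
    B.card = k → fixedCount ρ B ≤ 1 ∨ fixedCount ρ W ≤ 1 →
    fixedCount ρ B + fixedCount ρ W ≤ 4 →
    lowerBound k (fixedCount ρ B) (fixedCount ρ W) (sameArcs ρ B) ≤ meanFaces ρ B W := by
  induction k with
  | zero =>
    intro ρ B W h hk _ _
    obtain ⟨h1, h2, h3, h4⟩ := h.meanFaces_of_card_eq_zero hk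
    rw [h1, h2, h3, h4]
    simp [lowerBound, lowerWeight, recip]
  | succ k ih =>
    intro ρ B W h hk hmin hf
    have hkW : W.card = k + 1 := h.card_eq ▸ hk
    -- Fixed points are removed only when both colours have one or a colour has at least three. What
    -- remains has one colour without fixed points and at most two in the other.
    by_cases hpB : (fixedCount ρ B = 1 ∧ 1 ≤ fixedCount ρ W ∧ fixedCount ρ W ≤ 3) ∨
        (3 ≤ fixedCount ρ B ∧ fixedCount ρ B ≤ 4 ∧ fixedCount ρ W = 0)
    · obtain ⟨b, hb, hbf⟩ := exists_fixed_of_pos (ρ := ρ) (B := B) (by omega)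
      exact h.lower_of_fixed ih hk hpB hb hbf
    by_cases hpW : (fixedCount ρ W = 1 ∧ 1 ≤ fixedCount ρ B ∧ fixedCount ρ B ≤ 3) ∨
        (3 ≤ fixedCount ρ W ∧ fixedCount ρ W ≤ 4 ∧ fixedCount ρ B = 0)
    · obtain ⟨b, hb, hbf⟩ := exists_fixed_of_pos (ρ := ρ) (B := W) (by omega)
      have := h.symm.lower_of_fixed ih hkW hpW hb hbf
      rwa [meanFaces_comm ρ h.symm.card_eq, h.sameArcs_comm, lowerBound_comm] at this
    have h0 : fixedCount ρ B = 0 ∨ fixedCount ρ W = 0 := by omega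
    have hB2 : fixedCount ρ B ≤ 2 := by omega
    have hW2 : fixedCount ρ W ≤ 2 := by omega
    by_cases hmono : ∀ x ∈ B, ρ x ∈ B
    · rcases h0 with hB0 | hW0
      · exact h.lower_of_monochromatic ih hk hB0 hW2 hmono
      · have hmonoW := sameArcs_eq_card_iff.1 (h.sameArcs_comm.trans
          ((sameArcs_eq_card_iff.2 hmono).trans h.card_eq))
        have := h.symm.lower_of_monochromatic ih hkW hW0 hB2 hmonoW
        rwa [meanFaces_comm ρ h.symm.card_eq, h.sameArcs_comm, lowerBound_comm] at this
    rcases h.exists_boundary_or_alternating hmono with ⟨b, hb, h1, h2⟩ | ⟨b, hb, h1, h2⟩ |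
      ⟨b, hb, h1, h2⟩ | ⟨b, hb, h1, h2⟩ | ⟨b, hb, h1, h2, h3, h4⟩
    · exact h.lower_of_boundary ih hk h0 hB2 hW2 hb h1 h2
    · have := h.inv.lower_of_boundary ih hk (by simpa only [fixedCount_inv] using h0)
        (by rwa [fixedCount_inv]) (by rwa [fixedCount_inv]) hb (by rwa [inv_inv]) h2
      rwa [meanFaces_inv, fixedCount_inv, fixedCount_inv, sameArcs_inv] at this
    · have := h.symm.lower_of_boundary ih hkW h0.symm hW2 hB2 hb h1 h2
      rwa [meanFaces_comm ρ h.symm.card_eq, h.sameArcs_comm, lowerBound_comm] at this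
    · have := h.inv.symm.lower_of_boundary ih hkW (by simpa only [fixedCount_inv] using h0.symm)
        (by rwa [fixedCount_inv]) (by rwa [fixedCount_inv]) hb (by rwa [inv_inv]) h2
      rwa [meanFaces_inv, fixedCount_inv, fixedCount_inv, sameArcs_inv,
        meanFaces_comm ρ h.symm.card_eq, h.sameArcs_comm, lowerBound_comm] at this
    · exact h.lower_of_alternating ih hk hmin hf hb h1 h2 h3 h4

end Induction

/-! ### From matchings back to conjugacy classes -/

section Average

variable {n : ℕ}

/-- The first copy of `Fin n` in `Fin n ⊕ Fin n`. -/
def leftCopy (n : ℕ) : Finset (Fin n ⊕ Fin n) := Finset.univ.map Function.Embedding.inl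

/-- The second copy of `Fin n` in `Fin n ⊕ Fin n`. -/
def rightCopy (n : ℕ) : Finset (Fin n ⊕ Fin n) := Finset.univ.map Function.Embedding.inr

theorem mem_leftCopy {x : Fin n ⊕ Fin n} : x ∈ leftCopy n ↔ ∃ a, x = Sum.inl a := by
  simp [leftCopy, eq_comm]

theorem mem_rightCopy {x : Fin n ⊕ Fin n} : x ∈ rightCopy n ↔ ∃ a, x = Sum.inr a := by
  simp [rightCopy, eq_comm]

theorem isBicolored_sumCongr (σ τ : Perm (Fin n)) :
    IsBicolored (Perm.sumCongr σ τ) (leftCopy n) (rightCopy n) := by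
  refine ⟨?_, by simp [leftCopy, rightCopy], ?_⟩
  · rw [Finset.disjoint_left]
    intro x hx hx'
    obtain ⟨a, rfl⟩ := mem_leftCopy.1 hx
    obtain ⟨b, hb⟩ := mem_rightCopy.1 hx'
    cases hb
  · rintro (a | a) h1 h2
    · exact absurd (mem_leftCopy.2 ⟨a, rfl⟩) h1
    · exact absurd (mem_rightCopy.2 ⟨a, rfl⟩) h2

/-- The matching of the two copies of `Fin n` given by a permutation. -/
def matchingOfPerm (π : Perm (Fin n)) : Perm (Fin n ⊕ Fin n) where
  toFun := Sum.elim (fun a => Sum.inr (π a)) (fun a => Sum.inl (π.symm a))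
  invFun := Sum.elim (fun a => Sum.inr (π a)) (fun a => Sum.inl (π.symm a))
  left_inv := by rintro (a | a) <;> simp
  right_inv := by rintro (a | a) <;> simp

/-- The product alternates between the copies, and its square on the first copy is `σ * (π⁻¹ * τ *
π)`. -/
theorem cycleCount_sumCongr_mul_matchingOfPerm (σ τ π : Perm (Fin n)) :
    cycleCount (Perm.sumCongr σ τ * matchingOfPerm π) = numCycles (σ * (π⁻¹ * τ * π)) := by
  rw [numCycles_eq_cycleCount]
  exact cycleCount_eq_of_alternating _ (π.trans τ) (π.symm.trans σ) (fun a => rfl) (fun a => rfl)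

theorem sum_matchings_copies {M : Type} [AddCommMonoid M] (f : Perm (Fin n ⊕ Fin n) → M) :
    ∑ ι ∈ matchings (leftCopy n) (rightCopy n), f ι =
      ∑ π : Perm (Fin n), f (matchingOfPerm π) := by
  symm
  refine Finset.sum_bij (fun π _ => matchingOfPerm π) ?_ ?_ ?_ (fun _ _ => rfl)
  · intro π _
    rw [mem_matchings]
    refine ⟨?_, ?_, ?_, ?_⟩
    · rintro (a | a) <;> simp [matchingOfPerm]
    · intro x hx
      obtain ⟨a, rfl⟩ := mem_leftCopy.1 hx
      exact mem_rightCopy.2 ⟨π a, rfl⟩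
    · intro x hx
      obtain ⟨a, rfl⟩ := mem_rightCopy.1 hx
      exact mem_leftCopy.2 ⟨π.symm a, rfl⟩
    · rintro (a | a) h1 h2
      · exact absurd (mem_leftCopy.2 ⟨a, rfl⟩) h1
      · exact absurd (mem_rightCopy.2 ⟨a, rfl⟩) h2
  · intro π _ π' _ h
    ext a
    have := congrArg (fun e => e (Sum.inl a)) h
    simp only [matchingOfPerm, Equiv.coe_fn_mk, Sum.elim_inl, Sum.inr.injEq] at this
    rw [this]
  · intro ι hι
    obtain ⟨h1, h2, h3, h4⟩ := mem_matchings.1 hι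
    have h5 : ∀ a, ∃ b, ι (Sum.inl a) = Sum.inr b := fun a =>
      mem_rightCopy.1 (h2 _ (mem_leftCopy.2 ⟨a, rfl⟩))
    have h6 : ∀ a, ∃ b, ι (Sum.inr a) = Sum.inl b := fun a =>
      mem_leftCopy.1 (h3 _ (mem_rightCopy.2 ⟨a, rfl⟩))
    choose f hf using h5
    choose g hg using h6
    refine ⟨⟨f, g, fun a => ?_, fun a => ?_⟩, Finset.mem_univ _, ?_⟩
    · have := h1 (Sum.inl a)
      rw [hf, hg] at this
      exact Sum.inl_injective this
    · have := h1 (Sum.inr a)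
      rw [hg, hf] at this
      exact Sum.inr_injective this
    · ext x
      rcases x with a | a
      · rw [hf]; rfl
      · rw [hg]; rfl

theorem meanFaces_sumCongr (σ τ : Perm (Fin n)) :
    meanFaces (Perm.sumCongr σ τ) (leftCopy n) (rightCopy n) =
      (∑ π : Perm (Fin n), (numCycles (σ * (π⁻¹ * τ * π)) : ℝ)) / (n.factorial : ℝ) := by
  rw [meanFaces, sum_matchings_copies]
  simp only [cycleCount_sumCongr_mul_matchingOfPerm]
  simp [leftCopy]
  ring

theorem sameArcs_sumCongr (σ τ : Perm (Fin n)) :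
    sameArcs (Perm.sumCongr σ τ) (leftCopy n) = n := by
  have h : (leftCopy n).card = n := by simp [leftCopy]
  rw [sameArcs_eq_card_iff.2, h]
  intro x hx
  obtain ⟨a, rfl⟩ := mem_leftCopy.1 hx
  exact mem_leftCopy.2 ⟨σ a, rfl⟩

theorem apply_ne_of_one_notMem {σ : Perm (Fin n)} (h : 1 ∉ σ.partition.parts) (a : Fin n) :
    σ a ≠ a := by
  intro ha
  apply h
  rw [parts_partition, Multiset.mem_add]
  right
  rw [Multiset.mem_replicate]
  refine ⟨?_, rfl⟩
  have : σ.support.card < Fintype.card (Fin n) := by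
    rw [← Finset.card_univ]
    exact Finset.card_lt_card (Finset.ssubset_univ_iff.2 fun hu => by
      have := Finset.mem_univ a
      rw [← hu, mem_support] at this
      exact this ha)
  omega

theorem fixedCount_sumCongr_left {σ : Perm (Fin n)} (τ : Perm (Fin n))
    (h : 1 ∉ σ.partition.parts) : fixedCount (Perm.sumCongr σ τ) (leftCopy n) = 0 := by
  refine Finset.card_eq_zero.2 (Finset.filter_eq_empty_iff.2 fun x hx hfx => ?_)
  obtain ⟨a, rfl⟩ := mem_leftCopy.1 hx
  exact apply_ne_of_one_notMem h a (Sum.inl_injective hfx)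

theorem fixedCount_sumCongr_right (σ : Perm (Fin n)) {τ : Perm (Fin n)}
    (h : 1 ∉ τ.partition.parts) : fixedCount (Perm.sumCongr σ τ) (rightCopy n) = 0 := by
  refine Finset.card_eq_zero.2 (Finset.filter_eq_empty_iff.2 fun x hx hfx => ?_)
  obtain ⟨a, rfl⟩ := mem_rightCopy.1 hx
  exact apply_ne_of_one_notMem h a (Sum.inr_injective hfx)

theorem average_conj_bounds {σ τ : Perm (Fin n)} (hσ : 1 ∉ σ.partition.parts)
    (hτ : 1 ∉ τ.partition.parts) :
    (harmonic n : ℝ) - 3 <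
        (∑ π : Perm (Fin n), (numCycles (σ * (π⁻¹ * τ * π)) : ℝ)) / (n.factorial : ℝ) ∧
      (∑ π : Perm (Fin n), (numCycles (σ * (π⁻¹ * τ * π)) : ℝ)) / (n.factorial : ℝ) ≤
        (harmonic n : ℝ) + 1 := by
  have hb := isBicolored_sumCongr σ τ
  have hk : (leftCopy n).card = n := by simp [leftCopy]
  have h1 := fixedCount_sumCongr_left τ hσ
  have h2 := fixedCount_sumCongr_right σ hτ
  have h3 := sameArcs_sumCongr σ τ
  have hu := meanFaces_le_upperBound n _ _ _ hb hk (by omega)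
  have hl := lowerBound_le_meanFaces n _ _ _ hb hk (by omega) (by omega)
  rw [h1, h2, h3, meanFaces_sumCongr] at hu hl
  have hr := recip_nonneg n
  constructor
  · refine lt_of_lt_of_le ?_ hl
    unfold lowerBound
    have : (0 : ℝ) ≤ lowerWeight 0 0 * recip n := mul_nonneg (by positivity) hr
    linarith
  · refine hu.trans ?_
    unfold upperBound
    have : (0 : ℝ) ≤ upperWeight 0 0 n * recip n := mul_nonneg (by positivity) hr
    linarith

theorem conj_mem_conjClass {α : n.Partition} (π : Perm (Fin n)) {τ : Perm (Fin n)} :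
    π⁻¹ * τ * π ∈ conjClass α ↔ τ ∈ conjClass α := by
  have : (π⁻¹ * τ * π).partition = τ.partition :=
    (partition_eq_of_isConj.1 (isConj_iff.2 ⟨π⁻¹, by rw [inv_inv]⟩)).symm
  simp [conjClass, this]

theorem sum_conjClass_conj (β : n.Partition) (π : Perm (Fin n)) (f : Perm (Fin n) → ℝ) :
    ∑ ω ∈ conjClass β, f (π⁻¹ * ω * π) = ∑ ω ∈ conjClass β, f ω := by
  refine Finset.sum_bij' (fun ω _ => π⁻¹ * ω * π) (fun ω _ => π * ω * π⁻¹) ?_ ?_ ?_ ?_ ?_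
  · intro ω hω; exact (conj_mem_conjClass π).2 hω
  · intro ω hω
    have := (conj_mem_conjClass (α := β) π⁻¹ (τ := ω)).2 hω
    rwa [inv_inv] at this
  · intro ω _; group
  · intro ω _; group
  · intro ω _; rfl

/-- Conjugation by `π` permutes the class of `β`, so averaging over `π` changes nothing; afterwards
each pair can be bounded separately. -/
theorem expectedCycles_eq_average (α β : n.Partition) :
    expectedCycles α β = (∑ σ ∈ conjClass α, ∑ ω ∈ conjClass β,
      (∑ π : Perm (Fin n), (numCycles (σ * (π⁻¹ * ω * π)) : ℝ)) / (n.factorial : ℝ)) /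
        ((conjClass α).card * (conjClass β).card) := by
  rw [expectedCycles]
  congr 1
  refine Finset.sum_congr rfl fun σ _ => ?_
  rw [← Finset.sum_div, Finset.sum_comm]
  have h : ∀ π : Perm (Fin n), ∑ ω ∈ conjClass β, (numCycles (σ * (π⁻¹ * ω * π)) : ℝ) =
      ∑ ω ∈ conjClass β, (numCycles (σ * ω) : ℝ) := fun π =>
    sum_conjClass_conj β π (fun ω => (numCycles (σ * ω) : ℝ))
  rw [Finset.sum_congr rfl fun π _ => h π, Finset.sum_const, Finset.card_univ, Fintype.card_perm,
    Fintype.card_fin, nsmul_eq_mul, mul_div_cancel_left₀]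
  positivity

end Average

end ProductsOfConjugacyClasses

theorem theorem1 (n : ℕ) (α β : n.Partition) (hα : 1 ∉ α.parts) (hβ : 1 ∉ β.parts) :
    (harmonic n : ℝ) - 3 < expectedCycles α β ∧
      expectedCycles α β ≤ (harmonic n : ℝ) + 1 := by
  have hca : (0 : ℝ) < (conjClass α).card := by
    exact_mod_cast Finset.card_pos.2 (conjClass_nonempty α)
  have hcb : (0 : ℝ) < (conjClass β).card := by
    exact_mod_cast Finset.card_pos.2 (conjClass_nonempty β)
  have hpos : (0 : ℝ) < (conjClass α).card * (conjClass β).card := mul_pos hca hcb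
  have key : ∀ σ ∈ conjClass α, ∀ ω ∈ conjClass β, _ := fun σ hσ ω hω =>
    average_conj_bounds (σ := σ) (τ := ω)
      (by rwa [(Finset.mem_filter.1 hσ).2]) (by rwa [(Finset.mem_filter.1 hω).2])
  have hconst : ∀ c : ℝ, c * ((conjClass α).card * (conjClass β).card) =
      ∑ σ ∈ conjClass α, ∑ ω ∈ conjClass β, c := by
    intro c
    simp only [Finset.sum_const, nsmul_eq_mul]
    ring
  rw [expectedCycles_eq_average]
  constructor
  · rw [lt_div_iff₀ hpos, hconst]
    exact Finset.sum_lt_sum_of_nonempty (conjClass_nonempty α) fun σ hσ =>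
      Finset.sum_lt_sum_of_nonempty (conjClass_nonempty β) fun ω hω => (key σ hσ ω hω).1
  · rw [div_le_iff₀ hpos, hconst]
    exact Finset.sum_le_sum fun σ hσ => Finset.sum_le_sum fun ω hω => (key σ hσ ω hω).2
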